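/- Let $n\in\mathbb N\cup\{\infty\}$, let $A_n=\{1<2<\dots<n\}$ (all positive integers if $n=\infty$), let $A_n^*$ be the set of words on $A_n$, and let $1\le i<n$. A \emph{Young tableau} on $A_n$ (French convention) is a finite sequence of non-empty non-decreasing words (its rows, listed from top to bottom), each row $x_1\dots x_s$ and the next lower one $y_1\dots y_t$ satisfying $s\le t$ and $x_j>y_j$ for $1\le j\le s$. Its \emph{shape} is the sequence of its row lengths. Let $\mathbf{YT}$ be the set of tableaux on $A_n$ and $\mathbf{YT}^\lambda$ the set of those of shape $\lambda$. The row reading $\mathcal R(T)$ is the concatenation of the rows from top to bottom; the column reading $\mathcal C(T)$ is the concatenation of the columns from left to right, each read from top to bottom. The tableau map $\mathcal T\colon A_n^*\to\mathbf{YT}$ inserts the letters of a word one after another, by right Schensted insertion, into the empty tableau. Let $\sim$ be the Knuth equivalence on $A_n^*$, i.e. the congruence generated by $xzy\sim zxy$ ($x\le y<z$) and $yxz\sim yzx$ ($x<y\le z$). The operator $s_i\colon A_n^*\to A_n^*$ is defined as follows. Consider the letters $i$ and $i+1$ of a word $\boldsymbol w$, in order; match and forget consecutive letters $(i+1,i)$,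 where the pair (last letter, first letter) is also considered consecutive, and continue as long as possible. The unmatched letters are then either all $i$ or all $i+1$; change them all to $i+1$ or all to $i$ respectively, keeping every other letter of $\boldsymbol w$. The operator $s_i$ respects $\sim$, and so induces via the Knuth bijection $\mathbf{YT}\cong A_n^*/{\sim}$ an operator on $\mathbf{YT}$, also denoted $s_i$: one has $s_i(T)=\mathcal T(s_i(\mathcal R(T)))$ for every tableau $T$, and $s_i(\mathcal T(\boldsymbol w))=\mathcal T(s_i(\boldsymbol w))$ for every word $\boldsymbol w$. Then the following hold. \begin{enumerate} \item For every shape $\lambda$, the operator $s_i$ on $A_n^*$ maps $\mathcal R(\mathbf{YT}^\lambda)$ to itself and $\mathcal C(\mathbf{YT}^\lambda)$ to itself. \item The maps $\mathcal R,\mathcal C\colon\mathbf{YT}\to A_n^*$ are injective, and $\mathcal R(s_i(T))=s_i(\mathcal R(T))$ and $\mathcal C(s_i(T))=s_i(\mathcal C(T))$ for all $T\in\mathbf{YT}$. \item $s_i$ commutes with $\mathcal R\mathcal T$ and with $\mathcal C\mathcal T$ on $A_n^*$. \item For all $k\ge 0$, all shapes $\lambda_1,\dots,\lambda_k$ and all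 $\boldsymbol w_j\in\mathcal R(\mathbf{YT}^{\lambda_j})$, there is a unique decomposition $s_i(\boldsymbol w_1\cdots\boldsymbol w_k)=\widetilde{\boldsymbol w}_1\cdots\widetilde{\boldsymbol w}_k$ with $\widetilde{\boldsymbol w}_j\in\mathcal R(\mathbf{YT}^{\lambda_j})$ for all $j$. The same holds with $\mathcal C$ in place of $\mathcal R$. \item For any $T_1,\dots,T_k\in\mathbf{YT}$, let $\widetilde{\boldsymbol w}_j$ and $\widetilde{\boldsymbol v}_j$ be computed as in Point 4 from $\boldsymbol w_j=\mathcal R(T_j)$ and $\boldsymbol v_j=\mathcal C(T_j)$ respectively. Then $\mathcal T(\widetilde{\boldsymbol w}_j)=\mathcal T(\widetilde{\boldsymbol v}_j)$ for all $j$. \end{enumerate} -/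

import Mathlib

namespace Plactic

section Tableaux

variable {A : Type*} [LinearOrder A]

/-- The strict partial order on rows: `x₁ … x_s ≻ y₁ … y_t` iff `s ≤ t` and `x_i > y_i` for all
`i ≤ s`. -/
def RowGt (s t : List A) : Prop :=
  s.length ≤ t.length ∧ ∀ (i : ℕ) (hs : i < s.length) (ht : i < t.length), t[i] < s[i]

end Tableaux

/-- A Young tableau on a totally ordered alphabet `A` (French convention): a finite decreasing
sequence of non-empty rows, a row being a non-decreasing word. The rows are listed from top to
bottom. -/
@[ext]
structure YoungTableau (A : Type*) [LinearOrder A] where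
  rows : List (List A)
  rows_ne_nil : ∀ r ∈ rows, r ≠ []
  rows_sorted : ∀ r ∈ rows, r.Pairwise (· ≤ ·)
  rows_decreasing : rows.IsChain RowGt

section Insertion

variable {A : Type*} [LinearOrder A]

/-- Insertion of `x` in a row: `x` replaces the leftmost letter exceeding `x`, which is returned
as the second component; if there is none, `x` is attached at the right end. -/
def rowInsert (x : A) : List A → List A × Option A
  | [] => ([x], none)
  | y :: r => if x < y then (x :: r, some y) else (y :: (rowInsert x r).1, (rowInsert x r).2)

/-- Right Schensted insertion of `x`, on rows listed from BOTTOM to TOP. -/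
def insertUp (x : A) : List (List A) → List (List A)
  | [] => [[x]]
  | r :: rs =>
    match (rowInsert x r).2 with
    | none => (rowInsert x r).1 :: rs
    | some y => (rowInsert x r).1 :: insertUp y rs

theorem rowGt_nil (t : List A) : RowGt [] t := ⟨by simp, by simp⟩

theorem rowGt_cons {x y : A} {s t : List A} :
    RowGt (x :: s) (y :: t) ↔ y < x ∧ RowGt s t := by
  constructor
  · rintro ⟨h, h'⟩
    refine ⟨h' 0 (by simp) (by simp), by simpa using h, fun i hs ht => ?_⟩
    have := h' (i + 1) (by simpa using hs) (by simpa using ht)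
    rwa [List.getElem_cons_succ, List.getElem_cons_succ] at this
  · rintro ⟨h, h1, h2⟩
    refine ⟨by simpa using h1, fun i hs ht => ?_⟩
    cases i with
    | zero => simpa using h
    | succ i => simpa using h2 i (by simpa using hs) (by simpa using ht)

theorem not_rowGt_cons_nil {x : A} {s : List A} : ¬ RowGt (x :: s) [] := fun h => by
  have := h.1
  simp at this

theorem rowInsert_ne_nil (x : A) (r : List A) : (rowInsert x r).1 ≠ [] := by
  cases r with
  | nil => simp [rowInsert]
  | cons y r => by_cases h : x < y <;> simp [rowInsert, h]

theorem lt_of_rowInsert {x y : A} {r : List A} (h : (rowInsert x r).2 = some y) : x < y := by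
  induction r with
  | nil => simp [rowInsert] at h
  | cons z r ih =>
    by_cases hz : x < z
    · simp only [rowInsert, hz, if_true, Option.some.injEq] at h
      exact h ▸ hz
    · simp only [rowInsert, hz, if_false] at h
      exact ih h

theorem mem_rowInsert {x z : A} {r : List A} (h : z ∈ (rowInsert x r).1) : z = x ∨ z ∈ r := by
  induction r with
  | nil => simpa [rowInsert] using h
  | cons y r ih =>
    by_cases hy : x < y
    · simp only [rowInsert, hy, if_true, List.mem_cons] at h ⊢
      tauto
    · simp only [rowInsert, hy, if_false, List.mem_cons] at h ⊢
      tauto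

theorem rowInsert_sorted {x : A} {r : List A} (h : r.Pairwise (· ≤ ·)) :
    (rowInsert x r).1.Pairwise (· ≤ ·) := by
  induction r with
  | nil => simp [rowInsert]
  | cons y r ih =>
    rw [List.pairwise_cons] at h
    by_cases hy : x < y
    · simp only [rowInsert, hy, if_true, List.pairwise_cons]
      exact ⟨fun z hz => hy.le.trans (h.1 z hz), h.2⟩
    · simp only [rowInsert, hy, if_false, List.pairwise_cons]
      refine ⟨fun z hz => ?_, ih h.2⟩
      rcases mem_rowInsert hz with rfl | hz
      · exact not_lt.1 hy
      · exact h.1 z hz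

/-- Inserting into the lower row keeps the upper row above it. -/
theorem rowGt_rowInsert {x : A} {u r : List A} (h : RowGt u r) : RowGt u (rowInsert x r).1 := by
  induction r generalizing u with
  | nil =>
    cases u with
    | nil => exact rowGt_nil _
    | cons => exact absurd h not_rowGt_cons_nil
  | cons y r ih =>
    cases u with
    | nil => exact rowGt_nil _
    | cons z u =>
      rw [rowGt_cons] at h
      by_cases hy : x < y
      · simp only [rowInsert, hy, if_true, rowGt_cons]
        exact ⟨hy.trans h.1, h.2⟩
      · simp only [rowInsert, hy, if_false, rowGt_cons]
        exact ⟨h.1, ih h.2⟩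

/-- The row above stays above after it has received the letter chased from the lower row. -/
theorem rowGt_rowInsert_bump {x y : A} {u r : List A} (h : RowGt u r)
    (hy : (rowInsert x r).2 = some y) : RowGt (rowInsert y u).1 (rowInsert x r).1 := by
  induction r generalizing u with
  | nil => simp [rowInsert] at hy
  | cons z r ih =>
    by_cases hz : x < z
    · simp only [rowInsert, hz, if_true, Option.some.injEq] at hy ⊢
      subst hy
      cases u with
      | nil => simpa [rowInsert, rowGt_cons] using ⟨hz, rowGt_nil r⟩
      | cons w u =>
        rw [rowGt_cons] at h
        simp only [rowInsert, h.1, if_true, rowGt_cons]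
        exact ⟨hz, h.2⟩
    · simp only [rowInsert, hz, if_false] at hy ⊢
      have hzy : z < y := (not_lt.1 hz).trans_lt (lt_of_rowInsert hy)
      cases u with
      | nil => simpa [rowInsert, rowGt_cons] using ⟨hzy, rowGt_nil _⟩
      | cons w u =>
        rw [rowGt_cons] at h
        by_cases hw : y < w
        · simp only [rowInsert, hw, if_true, rowGt_cons]
          exact ⟨hzy, rowGt_rowInsert h.2⟩
        · simp only [rowInsert, hw, if_false, rowGt_cons]
          exact ⟨h.1, ih h.2 hy⟩

theorem insertUp_head (x : A) (r : List A) (rs : List (List A)) :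
    ∃ l, insertUp x (r :: rs) = (rowInsert x r).1 :: l := by
  rw [insertUp]
  cases (rowInsert x r).2 with
  | none => exact ⟨_, rfl⟩
  | some y => exact ⟨_, rfl⟩

theorem insertUp_rows {x : A} {rs : List (List A)}
    (h1 : ∀ r ∈ rs, r ≠ []) (h2 : ∀ r ∈ rs, r.Pairwise (· ≤ ·)) :
    (∀ r ∈ insertUp x rs, r ≠ []) ∧ ∀ r ∈ insertUp x rs, r.Pairwise (· ≤ ·) := by
  induction rs generalizing x with
  | nil => simp [insertUp]
  | cons r rs ih =>
    simp only [List.mem_cons, forall_eq_or_imp] at h1 h2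
    rw [insertUp]
    cases (rowInsert x r).2 with
    | none =>
      simp only [List.mem_cons, forall_eq_or_imp]
      exact ⟨⟨rowInsert_ne_nil x r, h1.2⟩, rowInsert_sorted h2.1, h2.2⟩
    | some y =>
      have := ih (x := y) h1.2 h2.2
      simp only [List.mem_cons, forall_eq_or_imp]
      exact ⟨⟨rowInsert_ne_nil x r, this.1⟩, rowInsert_sorted h2.1, this.2⟩

theorem insertUp_chain {x : A} {rs : List (List A)}
    (h : rs.IsChain (fun lo up => RowGt up lo)) :
    (insertUp x rs).IsChain (fun lo up => RowGt up lo) := by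
  induction rs generalizing x with
  | nil => simp [insertUp]
  | cons r rs ih =>
    rw [insertUp]
    cases hx : (rowInsert x r).2 with
    | none =>
      cases rs with
      | nil => simp
      | cons u rs =>
        rw [List.isChain_cons_cons] at h
        exact List.isChain_cons_cons.2 ⟨rowGt_rowInsert h.1, h.2⟩
    | some y =>
      cases rs with
      | nil =>
        refine List.isChain_cons_cons.2 ⟨?_, by simp⟩
        exact rowGt_rowInsert_bump (rowGt_nil r) hx
      | cons u rs =>
        rw [List.isChain_cons_cons] at h
        have := ih (x := y) h.2
        obtain ⟨l, hl⟩ := insertUp_head y u rs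
        simp only [hl] at this ⊢
        exact List.isChain_cons_cons.2 ⟨rowGt_rowInsert_bump h.1 hx, this⟩

end Insertion

namespace YoungTableau

variable {A : Type*} [LinearOrder A]

/-- The empty tableau. -/
def empty : YoungTableau A := ⟨[], by simp, by simp, by simp⟩

/-- Right Schensted insertion of one letter; it starts in the last (bottom) row. -/
def insert (T : YoungTableau A) (x : A) : YoungTableau A where
  rows := (insertUp x T.rows.reverse).reverse
  rows_ne_nil r hr := (insertUp_rows (by simpa using T.rows_ne_nil)
    (by simpa using T.rows_sorted)).1 r (List.mem_reverse.1 hr)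
  rows_sorted r hr := (insertUp_rows (by simpa using T.rows_ne_nil)
    (by simpa using T.rows_sorted)).2 r (List.mem_reverse.1 hr)
  rows_decreasing := List.isChain_reverse.2
    (insertUp_chain (List.isChain_reverse.2 T.rows_decreasing))

/-- The tableau map: insert the letters of the word, from left to right, into the empty tableau. -/
def ofWord (w : List A) : YoungTableau A := w.foldl insert empty

/-- The row reading: rows from top to bottom, each row from left to right. -/
def rowReading (T : YoungTableau A) : List A := T.rows.flatten

/-- The number of columns, that is, the length of the bottom row. -/
def numCols (T : YoungTableau A) : ℕ := (T.rows.getLast?.getD []).length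

/-- The `j`-th column (counted from `0`), read from top to bottom. -/
def column (T : YoungTableau A) (j : ℕ) : List A := T.rows.filterMap (fun r => r[j]?)

/-- The column reading: columns from left to right, each column from top to bottom. -/
def colReading (T : YoungTableau A) : List A := (List.range T.numCols).flatMap T.column

/-- The shape: the sequence of the lengths of the rows (listed from top to bottom). -/
def shape (T : YoungTableau A) : List ℕ := T.rows.map List.length

end YoungTableau

section Knuth

variable {A : Type*} [LinearOrder A]

/-- One application of a Knuth relation `xzy ∼ zxy` (`x ≤ y < z`) or `yxz ∼ yzx` (`x < y ≤ z`)
inside a word. -/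
inductive KnuthStep : List A → List A → Prop
  | xzy (u v : List A) (x y z : A) : x ≤ y → y < z →
      KnuthStep (u ++ [x, z, y] ++ v) (u ++ [z, x, y] ++ v)
  | yxz (u v : List A) (x y z : A) : x < y → y ≤ z →
      KnuthStep (u ++ [y, x, z] ++ v) (u ++ [y, z, x] ++ v)

/-- Knuth equivalence of words; its classes are the elements of the plactic monoid. -/
def KnuthEquiv (w w' : List A) : Prop := Relation.EqvGen KnuthStep w w'

end Knuth

section LetterPermutation

variable {A : Type*} [DecidableEq A]

/-- Put a letter occurrence `x` (a letter with its position) in front of a list of unmatched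
occurrences. If `x` is a `b` and the next unmatched occurrence is an `a`, these two are matched
and forgotten. -/
def cancel (a b : A) (x : A × ℕ) : List (A × ℕ) → List (A × ℕ)
  | [] => [x]
  | y :: l => if x.1 = b ∧ y.1 = a then l else x :: y :: l

/-- The occurrences of `a` and `b` in `w` that are left when consecutive pairs `(b, a)` have been
repeatedly matched and forgotten, without wrapping around: some `a`s followed by some `b`s. -/
def linearUnmatched (a b : A) (w : List A) : List (A × ℕ) :=
  (w.zipIdx.filter (fun x => x.1 = a ∨ x.1 = b)).foldr (cancel a b) []

/-- Match and forget the pair (last occurrence, first occurrence) if it is a pair `(b, a)`. -/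
def cyclicCancel (a b : A) (l : List (A × ℕ)) : List (A × ℕ) :=
  if l.getLast?.map Prod.fst = some b ∧ l.head?.map Prod.fst = some a then l.tail.dropLast else l

/-- The occurrences of `a` and `b` in `w` that are left unmatched when consecutive pairs `(b, a)`,
with the word considered cyclically, are matched and forgotten as long as possible. They are all
equal to `a` or all equal to `b`. -/
def unmatched (a b : A) (w : List A) : List (A × ℕ) :=
  (cyclicCancel a b)^[w.length] (linearUnmatched a b w)

/-- The letter permuting operator for letters `a`, `b`: it changes all the unmatched `a`s into
`b`s, or all the unmatched `b`s into `a`s, and keeps all the other letters. -/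
def letterPerm (a b : A) (w : List A) : List A :=
  w.zipIdx.map (fun x => if x ∈ unmatched a b w then (if x.1 = a then b else a) else x.1)

end LetterPermutation

/-- The alphabet `A_n = {1, 2, …, n}` for `n ∈ ℕ ∪ {∞}`; `A_∞` consists of all positive
integers. -/
abbrev Alphabet (n : ℕ∞) : Type := {a : ℕ // 1 ≤ a ∧ (a : ℕ∞) ≤ n}

/-- The operator `s_i`, `1 ≤ i < n`, on words on `A_n`. -/
def sWord {n : ℕ∞} (i : ℕ) (hi : 1 ≤ i) (hn : (i : ℕ∞) < n) (w : List (Alphabet n)) :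
    List (Alphabet n) :=
  letterPerm ⟨i, hi, hn.le⟩
    ⟨i + 1, Nat.le_add_left 1 i, by push_cast; exact Order.add_one_le_of_lt hn⟩ w

/-- The operator `s_i` induced on Young tableaux: send `T` to the class of its row reading in the
plactic monoid, apply `s_i` there, and go back with the tableau map. -/
def sTableau {n : ℕ∞} (i : ℕ) (hi : 1 ≤ i) (hn : (i : ℕ∞) < n) (T : YoungTableau (Alphabet n)) :
    YoungTableau (Alphabet n) :=
  YoungTableau.ofWord (sWord i hi hn T.rowReading)

/-- The set of row readings of the tableaux of shape `lam`. -/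
def rowReadings (A : Type*) [LinearOrder A] (lam : List ℕ) : Set (List A) :=
  YoungTableau.rowReading '' {T | T.shape = lam}

/-- The set of column readings of the tableaux of shape `lam`. -/
def colReadings (A : Type*) [LinearOrder A] (lam : List ℕ) : Set (List A) :=
  YoungTableau.colReading '' {T | T.shape = lam}

/-- The concatenation `w₁ … w_k` of words. -/
def concat {A : Type*} {k : ℕ} (w : Fin k → List A) : List A := (List.ofFn w).flatten

end Plactic

/-! Write `a` for i and `b` for i+1, and read `b` as an opening and `a` as a closing bracket.
Deleting matched pairs without wrapping around leaves a^p b^q, where p is `freeA` and q is `freeB`.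
The crystal operator `Raise` replaces a^p b^q by a^(p-1) b^(q+1) on the same unmatched positions.
Within a class of the equivalence it generates (a string, `SameString`) a word is determined by p.
Cyclic matching pairs off min(p, q) further letters at the two ends, so s_i replaces a^p b^q by a^q
b^p: it reflects every string (`letterPerm_eq_fill`, `SameString.eq_letterPerm`). Hence it suffices
to follow a single raise or lowering.

Three facts about such a move carry the theorem. Knuth equivalent words have the same p and q, and
their raises are again Knuth equivalent (`KnuthEquiv.exists_raise`, `KnuthEquiv.exists_raise_to`). A
raise or lowering of a row or column reading is the reading of a tableau of the same shape, because
any violated inequality would produce a further unmatched letter on the forbidden side of the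
modified one. Finally, by the signature rule, moving a product moves exactly one factor, and which
one depends only on the counts p, q of the factors (`Raise.of_append_left`,
`Raise.of_append_right`).

Knuth's theorem links words and tableaux: the tableau map is constant on Knuth classes and is a left
inverse of both readings, and the two readings of a tableau are Knuth equivalent. Decompositions
exist by the signature rule and are unique because the shapes fix the lengths of the factors. For
the last point, Knuth equivalent factors are moved in parallel, so the resulting factors stay Knuth
equivalent. -/

namespace Plactic

/-! ### Bracketing counts, the crystal operator and the signature rule -/

section Signature

variable {A : Type*} [DecidableEq A]

/-- The number of occurrences of `a` in `w` that remain unmatched when consecutive pairs `(b, a)`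
are repeatedly matched and forgotten, without wrapping around. -/
def freeA (a b : A) : List A → ℕ
  | [] => 0
  | x :: w => if x = a then freeA a b w + 1 else if x = b then freeA a b w - 1 else freeA a b w

/-- The number of occurrences of `b` in `w` that remain unmatched when consecutive pairs `(b, a)`
are repeatedly matched and forgotten, without wrapping around. -/
def freeB (a b : A) : List A → ℕ
  | [] => 0
  | x :: w =>
    if x = a then freeB a b w
    else if x = b then freeB a b w + (1 - freeA a b w) else freeB a b w

/-- `w'` arises from `w` by changing the last unmatched `a` into `b`. -/
def Raise (a b : A) (w w' : List A) : Prop :=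
  ∃ u v, w = u ++ a :: v ∧ w' = u ++ b :: v ∧ freeB a b u = 0 ∧ freeA a b v = 0

variable {a b : A}

@[simp] theorem freeA_nil : freeA a b [] = 0 := rfl

@[simp] theorem freeB_nil : freeB a b [] = 0 := rfl

@[simp] theorem freeA_cons_left (w : List A) : freeA a b (a :: w) = freeA a b w + 1 := by
  simp [freeA]

@[simp] theorem freeB_cons_left (w : List A) : freeB a b (a :: w) = freeB a b w := by
  simp [freeB]

theorem freeA_cons_right (hab : a ≠ b) (w : List A) : freeA a b (b :: w) = freeA a b w - 1 := by
  simp [freeA, hab.symm]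

theorem freeB_cons_right (hab : a ≠ b) (w : List A) :
    freeB a b (b :: w) = freeB a b w + (1 - freeA a b w) := by
  simp [freeB, hab.symm]

theorem freeA_cons_of_ne {x : A} (ha : x ≠ a) (hb : x ≠ b) (w : List A) :
    freeA a b (x :: w) = freeA a b w := by
  simp [freeA, ha, hb]

theorem freeB_cons_of_ne {x : A} (ha : x ≠ a) (hb : x ≠ b) (w : List A) :
    freeB a b (x :: w) = freeB a b w := by
  simp [freeB, ha, hb]

/-- If `u` reduces to a^p b^q and `v` to a^r b^s, the product reduces from a^p b^q a^r b^s by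
cancelling min(q, r) pairs in the middle. Truncated subtraction records what survives on either
side. -/
theorem free_append (u v : List A) :
    freeA a b (u ++ v) = freeA a b u + (freeA a b v - freeB a b u) ∧
      freeB a b (u ++ v) = freeB a b v + (freeB a b u - freeA a b v) := by
  induction u with
  | nil => simp
  | cons x u ih =>
    obtain ⟨h1, h2⟩ := ih
    simp only [List.cons_append, freeA, freeB, h1, h2]
    split_ifs <;> omega

theorem freeA_append (u v : List A) :
    freeA a b (u ++ v) = freeA a b u + (freeA a b v - freeB a b u) := (free_append u v).1

theorem freeB_append (u v : List A) :
    freeB a b (u ++ v) = freeB a b v + (freeB a b u - freeA a b v) := (free_append u v).2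

theorem freeA_add_freeB_le_length (w : List A) : freeA a b w + freeB a b w ≤ w.length := by
  induction w with
  | nil => simp
  | cons x w ih =>
    simp only [freeA, freeB, List.length_cons]
    split_ifs <;> omega

theorem freeA_eq_zero_of_notMem {w : List A} (h : a ∉ w) : freeA a b w = 0 := by
  induction w with
  | nil => rfl
  | cons x w ih =>
    simp only [List.mem_cons, not_or] at h
    simp only [freeA, if_neg (Ne.symm h.1), ih h.2]
    split_ifs <;> rfl

theorem freeB_eq_zero_of_notMem {w : List A} (h : b ∉ w) : freeB a b w = 0 := by
  induction w with
  | nil => rfl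
  | cons x w ih =>
    simp only [List.mem_cons, not_or] at h
    simp only [freeB, if_neg (Ne.symm h.1), ih h.2]
    split_ifs <;> rfl

theorem freeA_pos_of_mem {w : List A} (ha : a ∈ w) (hb : b ∉ w) : 0 < freeA a b w := by
  obtain ⟨u, v, rfl⟩ := List.append_of_mem ha
  simp only [List.mem_append, List.mem_cons, not_or] at hb
  rw [freeA_append, freeB_eq_zero_of_notMem hb.1, freeA_cons_left]
  omega

theorem freeB_pos_of_mem (hab : a ≠ b) {w : List A} (hb : b ∈ w) (ha : a ∉ w) :
    0 < freeB a b w := by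
  obtain ⟨u, v, rfl⟩ := List.append_of_mem hb
  simp only [List.mem_append, List.mem_cons, not_or] at ha
  rw [freeB_append, freeB_cons_right hab, freeA_eq_zero_of_notMem ha.2.2]
  omega

theorem append_cons_eq_append_iff {α : Type*} {s t u v : List α} {c : α} :
    u ++ v = s ++ c :: t ↔
      (∃ r, u = s ++ c :: r ∧ t = r ++ v) ∨ ∃ r, s = u ++ r ∧ v = r ++ c :: t := by
  rw [List.append_eq_append_iff]
  constructor
  · rintro (⟨r, rfl, rfl⟩ | ⟨r, rfl, h⟩)
    · exact .inr ⟨r, rfl, rfl⟩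
    · cases r with
      | nil => exact .inr ⟨[], by simp, by simpa using h.symm⟩
      | cons y r =>
        simp only [List.cons_append, List.cons.injEq] at h
        exact .inl ⟨r, by simp [h.1], h.2⟩
  · rintro (⟨r, rfl, rfl⟩ | ⟨r, rfl, rfl⟩)
    · exact .inr ⟨c :: r, rfl, rfl⟩
    · exact .inl ⟨r, rfl, rfl⟩

namespace Raise

theorem free (hab : a ≠ b) {w w' : List A} (h : Raise a b w w') :
    freeA a b w = freeA a b w' + 1 ∧ freeB a b w' = freeB a b w + 1 := by
  obtain ⟨u, v, rfl, rfl, hu, hv⟩ := h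
  simp only [freeA_append, freeB_append, freeA_cons_left, freeB_cons_left,
    freeA_cons_right hab, freeB_cons_right hab]
  omega

theorem length_eq {w w' : List A} (h : Raise a b w w') : w.length = w'.length := by
  obtain ⟨u, v, rfl, rfl, -, -⟩ := h
  simp

/-- The bound says that the free `b`s of `u` absorb all free `a`s of `v`, so the last unmatched `a`
of `u` is still the last one in the product. -/
theorem append_right {u u' : List A} (h : Raise a b u u') {v : List A}
    (hv : freeA a b v ≤ freeB a b u) : Raise a b (u ++ v) (u' ++ v) := by
  obtain ⟨s, t, rfl, rfl, hs, ht⟩ := h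
  refine ⟨s, t ++ v, by simp, by simp, hs, ?_⟩
  rw [freeB_append, freeB_cons_left, freeA_cons_left] at hv
  rw [freeA_append]
  omega

/-- The free `b`s of `u` absorb the first free `a`s of `v`. The last one survives exactly when `u`
has no more free `b`s than `v` has other free `a`s, whose number is `freeA a b v'`. -/
theorem append_left (hab : a ≠ b) {v v' : List A} (h : Raise a b v v') {u : List A}
    (hu : freeB a b u ≤ freeA a b v') : Raise a b (u ++ v) (u ++ v') := by
  obtain ⟨s, t, rfl, rfl, hs, ht⟩ := h
  refine ⟨u ++ s, t, by simp, by simp, ?_, ht⟩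
  rw [freeA_append, freeA_cons_right hab] at hu
  rw [freeB_append]
  omega

/-- Signature rule for raising: one factor moves, and comparing `freeA a b v` with `freeB a b u`
alone decides which. -/
theorem of_append_left {u v x : List A} (h : Raise a b (u ++ v) x) :
    (∃ u', x = u' ++ v ∧ Raise a b u u' ∧ freeA a b v ≤ freeB a b u) ∨
      ∃ v', x = u ++ v' ∧ Raise a b v v' ∧ freeB a b u < freeA a b v := by
  obtain ⟨s, t, h, rfl, hs, ht⟩ := h
  rcases append_cons_eq_append_iff.1 h with ⟨r, rfl, rfl⟩ | ⟨r, rfl, rfl⟩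
  · rw [freeA_append] at ht
    refine .inl ⟨s ++ b :: r, by simp, ⟨s, r, rfl, rfl, hs, by omega⟩, ?_⟩
    rw [freeB_append, freeB_cons_left, freeA_cons_left]
    omega
  · rw [freeB_append] at hs
    refine .inr ⟨r ++ b :: t, by simp, ⟨r, t, rfl, rfl, by omega, ht⟩, ?_⟩
    rw [freeA_append, freeA_cons_left]
    omega

/-- Signature rule for lowering. The counts are now those of the raised word, so the case of
equality passes to the other factor. -/
theorem of_append_right (hab : a ≠ b) {u v x : List A} (h : Raise a b x (u ++ v)) :
    (∃ u', x = u' ++ v ∧ Raise a b u' u ∧ freeA a b v < freeB a b u) ∨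
      ∃ v', x = u ++ v' ∧ Raise a b v' v ∧ freeB a b u ≤ freeA a b v := by
  obtain ⟨s, t, rfl, h, hs, ht⟩ := h
  rcases append_cons_eq_append_iff.1 h with ⟨r, rfl, rfl⟩ | ⟨r, rfl, rfl⟩
  · rw [freeA_append] at ht
    refine .inl ⟨s ++ a :: r, by simp, ⟨s, r, rfl, rfl, hs, by omega⟩, ?_⟩
    rw [freeB_append, freeB_cons_right hab]
    omega
  · rw [freeB_append] at hs
    refine .inr ⟨r ++ a :: t, by simp, ⟨r, t, rfl, rfl, by omega, ht⟩, ?_⟩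
    rw [freeA_append, freeA_cons_right hab]
    omega

theorem append_right' (hab : a ≠ b) {u u' : List A} (h : Raise a b u u') {v : List A}
    (hv : freeA a b v < freeB a b u') : Raise a b (u ++ v) (u' ++ v) :=
  h.append_right (by have := h.free hab; omega)

theorem append_left' (hab : a ≠ b) {v v' : List A} (h : Raise a b v v') {u : List A}
    (hu : freeB a b u < freeA a b v) : Raise a b (u ++ v) (u ++ v') :=
  h.append_left hab (by have := h.free hab; omega)

end Raise

theorem exists_raise (hab : a ≠ b) {w : List A} (h : 0 < freeA a b w) : ∃ w', Raise a b w w' := by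
  induction w with
  | nil => simp at h
  | cons x w ih =>
    by_cases hw : 0 < freeA a b w
    · obtain ⟨w', hw'⟩ := ih hw
      -- The raise of the tail fails to extend only if `x` is a `b` absorbing the single free `a` of
      -- the tail, and then the whole word has no free `a`.
      by_cases hx : x = b ∧ freeA a b w' = 0
      · have := hw'.free hab
        rw [hx.1, freeA_cons_right hab] at h
        omega
      · refine ⟨x :: w', hw'.append_left hab (u := [x]) ?_⟩
        simp only [freeB]
        split_ifs <;> grind
    · have hx : x = a := by
        by_contra hx
        simp only [freeA, if_neg hx] at h
        split_ifs at h <;> omega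
      exact ⟨b :: w, [], w, by simp [hx], rfl, rfl, by omega⟩

theorem exists_raise_to (hab : a ≠ b) {w : List A} (h : 0 < freeB a b w) :
    ∃ w', Raise a b w' w := by
  induction w with
  | nil => simp at h
  | cons x w ih =>
    -- Lowering changes the first unmatched `b`; this is the leading letter precisely in this case.
    by_cases hw : x = b ∧ freeA a b w = 0
    · exact ⟨a :: w, [], w, rfl, by simp [hw.1], rfl, hw.2⟩
    · have hx : 0 < freeB a b w := by
        simp only [freeB] at h
        split_ifs at h <;> grind
      obtain ⟨w', hw'⟩ := ih hx
      refine ⟨x :: w', hw'.append_left hab (u := [x]) ?_⟩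
      simp only [freeB]
      split_ifs <;> grind

end Signature

/-! ### The letter permuting operator as the reflection of strings -/

section LetterPerm

variable {A : Type*} [DecidableEq A] {a b : A}

/-- The unmatched occurrences of `a` and `b` in `w`, when its letters are numbered from `k`. -/
def unmatchedFrom (a b : A) : ℕ → List A → List (A × ℕ)
  | _, [] => []
  | k, x :: w =>
    if x = a ∨ x = b then cancel a b (x, k) (unmatchedFrom a b (k + 1) w)
    else unmatchedFrom a b (k + 1) w

theorem linearUnmatched_eq (w : List A) : linearUnmatched a b w = unmatchedFrom a b 0 w := by
  have key : ∀ (w : List A) (k : ℕ), ((w.zipIdx k).filter (fun x => x.1 = a ∨ x.1 = b)).foldr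
      (cancel a b) [] = unmatchedFrom a b k w := by
    intro w
    induction w with
    | nil => intro k; rfl
    | cons x w ih =>
      intro k
      rw [List.zipIdx_cons, List.filter_cons, unmatchedFrom, ← ih]
      by_cases h : x = a ∨ x = b <;> simp [h]
  exact key w 0

/-- Links the matching procedure on occurrences with the counts: what is left reads a^p b^q. -/
theorem map_fst_unmatchedFrom (hab : a ≠ b) (w : List A) (k : ℕ) :
    (unmatchedFrom a b k w).map Prod.fst =
      List.replicate (freeA a b w) a ++ List.replicate (freeB a b w) b := by
  induction w generalizing k with
  | nil => rfl
  | cons x w ih =>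
    specialize ih (k + 1)
    rw [unmatchedFrom]
    generalize unmatchedFrom a b (k + 1) w = l at ih
    by_cases hxa : x = a
    · subst hxa
      cases l <;> simp_all [cancel, List.replicate_succ]
    · by_cases hxb : x = b
      · subst hxb
        rw [freeA_cons_right hab, freeB_cons_right hab]
        rcases hA : freeA a x w with _ | p
        · rw [hA] at ih
          rcases hB : freeB a x w with _ | q
          · rw [hB] at ih
            cases l <;> simp_all [cancel]
          · rw [hB] at ih
            cases l with
            | nil => simp [List.replicate_succ] at ih
            | cons y l =>
              simp only [List.replicate_zero, List.nil_append, List.replicate_succ, List.map_cons,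
                List.cons.injEq] at ih
              simp [cancel, ih, List.replicate_succ, hab.symm]
        · rw [hA] at ih
          cases l with
          | nil => simp [List.replicate_succ] at ih
          | cons y l =>
            simp only [List.replicate_succ, List.map_cons, List.cons_append, List.cons.injEq] at ih
            simp [cancel, ih]
      · simpa [hxa, hxb, freeA, freeB] using ih

theorem unmatchedFrom_sublist (w : List A) (k : ℕ) :
    (unmatchedFrom a b k w).Sublist (w.zipIdx k) := by
  induction w generalizing k with
  | nil => simp [unmatchedFrom]
  | cons x w ih =>
    specialize ih (k + 1)
    rw [unmatchedFrom, List.zipIdx_cons]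
    generalize unmatchedFrom a b (k + 1) w = l at ih
    split_ifs
    · cases l with
      | nil => simp [cancel]
      | cons y l =>
        rw [cancel]
        split_ifs
        · exact ((List.sublist_cons_self y l).trans ih).cons _
        · exact ih.cons_cons _
    · exact ih.cons _

/-- Without a free `b` in `u`, no pair straddles the cut, so both parts are matched independently.
-/
theorem unmatchedFrom_append (hab : a ≠ b) {u : List A} (hu : freeB a b u = 0) (v : List A)
    (k : ℕ) :
    unmatchedFrom a b k (u ++ v) = unmatchedFrom a b k u ++ unmatchedFrom a b (k + u.length) v := by
  induction u generalizing k with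
  | nil => rfl
  | cons x u ih =>
    have hk : k + (x :: u).length = k + 1 + u.length := by simp only [List.length_cons]; omega
    rw [hk, List.cons_append, unmatchedFrom, unmatchedFrom]
    by_cases hxa : x = a
    · subst hxa
      rw [freeB_cons_left] at hu
      rw [ih hu]
      simp only [true_or, if_true]
      have : ∀ l, cancel x b (x, k) l = (x, k) :: l := by
        intro l; cases l <;> simp [cancel, hab]
      rw [this, this, List.cons_append]
    · by_cases hxb : x = b
      · subst hxb
        rw [freeB_cons_right hab] at hu
        rw [ih (by omega)]
        have h := map_fst_unmatchedFrom hab u (k + 1)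
        obtain ⟨p, hp⟩ : ∃ p, freeA a x u = p + 1 := ⟨freeA a x u - 1, by omega⟩
        rw [hp] at h
        generalize unmatchedFrom a x (k + 1) u = l at h
        cases l with
        | nil => simp [List.replicate_succ] at h
        | cons y l =>
          simp only [List.replicate_succ, List.map_cons, List.cons_append, List.cons.injEq] at h
          simp [cancel, h.1]
      · simp only [freeB, if_neg hxa, if_neg hxb] at hu
        simp [hxa, hxb, ih hu]

/-- The positions of the unmatched occurrences of `a` and `b` in `w`. -/
def unmatchedPos (a b : A) (w : List A) : List ℕ := (unmatchedFrom a b 0 w).map Prod.snd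

/-- Fill the unmatched positions of `w` with `n` letters `a`, followed by letters `b`. -/
def fill (a b : A) (n : ℕ) (w : List A) : List A :=
  w.zipIdx.map fun x => if x.2 ∈ unmatchedPos a b w then
    (if x.2 ∈ (unmatchedPos a b w).take n then a else b) else x.1

/-- The modified letter was the last unmatched `a` and becomes the first unmatched `b`. No pair
changes, so the unmatched positions are an invariant of the string. -/
theorem Raise.unmatchedPos_eq (hab : a ≠ b) {w w' : List A} (h : Raise a b w w') :
    unmatchedPos a b w' = unmatchedPos a b w ∧
      ∀ j, j ∉ unmatchedPos a b w → w'[j]? = w[j]? := by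
  obtain ⟨u, v, rfl, rfl, hu, hv⟩ := h
  have h1 : ∀ c, (c = a ∨ c = b) → unmatchedPos a b (u ++ c :: v) =
      (unmatchedFrom a b 0 u).map Prod.snd ++ u.length ::
        (unmatchedFrom a b (u.length + 1) v).map Prod.snd := by
    intro c hc
    have hm := map_fst_unmatchedFrom hab v (u.length + 1)
    rw [hv] at hm
    rw [unmatchedPos, unmatchedFrom_append hab hu, List.map_append, Nat.zero_add, unmatchedFrom,
      if_pos hc]
    generalize unmatchedFrom a b (u.length + 1) v = l at hm
    cases l with
    | nil => simp [cancel]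
    | cons y l =>
      have hy : y.1 ≠ a := by
        intro hy
        have : a ∈ (y :: l).map Prod.fst := by simp [hy]
        rw [hm] at this
        simp [hab] at this
      simp [cancel, hy]
  refine ⟨by rw [h1 b (.inr rfl), h1 a (.inl rfl)], fun j hj => ?_⟩
  rw [h1 a (.inl rfl)] at hj
  have hj' : j ≠ u.length := by rintro rfl; simp at hj
  rcases lt_or_gt_of_ne hj' with h | h
  · rw [List.getElem?_append_left h, List.getElem?_append_left h]
  · rw [List.getElem?_append_right h.le, List.getElem?_append_right h.le]
    obtain ⟨m, hm⟩ : ∃ m, j - u.length = m + 1 := ⟨j - u.length - 1, by omega⟩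
    simp [hm]

theorem getElem?_fill (n : ℕ) (w : List A) (j : ℕ) :
    (fill a b n w)[j]? = w[j]?.map fun x => if j ∈ unmatchedPos a b w then
      (if j ∈ (unmatchedPos a b w).take n then a else b) else x := by
  simp [fill, List.getElem?_zipIdx, Function.comp_def]

theorem Raise.fill_eq (hab : a ≠ b) {w w' : List A} (h : Raise a b w w') (n : ℕ) :
    fill a b n w' = fill a b n w := by
  obtain ⟨h1, h2⟩ := h.unmatchedPos_eq hab
  refine List.ext_getElem? fun j => ?_
  rw [getElem?_fill, getElem?_fill, h1]
  by_cases hj : j ∈ unmatchedPos a b w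
  · have hl := h.length_eq
    simp only [hj, if_true]
    by_cases hjl : j < w.length
    · rw [List.getElem?_eq_getElem hjl, List.getElem?_eq_getElem (hl ▸ hjl)]
      rfl
    · rw [List.getElem?_eq_none (by omega), List.getElem?_eq_none (by omega)]
  · rw [h2 j hj]

/-- Splits the unmatched positions into the positions `P` of `a`s and the later positions `Q` of
`b`s. -/
theorem exists_unmatched_eq_append (hab : a ≠ b) (w : List A) :
    ∃ P Q : List ℕ, unmatchedFrom a b 0 w = P.map (Prod.mk a) ++ Q.map (Prod.mk b) ∧
      unmatchedPos a b w = P ++ Q ∧ P.length = freeA a b w ∧ Q.length = freeB a b w ∧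
      (P ++ Q).Nodup ∧ (∀ j ∈ P, w[j]? = some a) ∧ ∀ j ∈ Q, w[j]? = some b := by
  have h := map_fst_unmatchedFrom hab w 0
  obtain ⟨l₁, l₂, hl, h1, h2⟩ := List.map_eq_append_iff.1 h
  have e1 : l₁ = (l₁.map Prod.snd).map (Prod.mk a) := by
    rw [List.map_map]
    conv_lhs => rw [← List.map_id l₁]
    refine List.map_congr_left fun x hx => ?_
    have : x.1 ∈ l₁.map Prod.fst := List.mem_map_of_mem hx
    rw [h1] at this
    exact Prod.ext (List.eq_of_mem_replicate this) rfl
  have e2 : l₂ = (l₂.map Prod.snd).map (Prod.mk b) := by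
    rw [List.map_map]
    conv_lhs => rw [← List.map_id l₂]
    refine List.map_congr_left fun x hx => ?_
    have : x.1 ∈ l₂.map Prod.fst := List.mem_map_of_mem hx
    rw [h2] at this
    exact Prod.ext (List.eq_of_mem_replicate this) rfl
  have hs := unmatchedFrom_sublist (a := a) (b := b) w 0
  have hmem : ∀ x ∈ unmatchedFrom a b 0 w, w[x.2]? = some x.1 := fun x hx =>
    List.mem_zipIdx_iff_getElem?.1 (hs.subset hx)
  refine ⟨l₁.map Prod.snd, l₂.map Prod.snd, by rw [← e1, ← e2, hl], by
    rw [unmatchedPos, hl, List.map_append], ?_, ?_, ?_, ?_, ?_⟩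
  · simpa using congrArg List.length h1
  · simpa using congrArg List.length h2
  · rw [← List.map_append, ← hl]
    refine (hs.map Prod.snd).nodup ?_
    rw [List.zipIdx_map_snd]
    exact List.nodup_range'
  · intro j hj
    have : (a, j) ∈ l₁ := by rw [e1]; exact List.mem_map_of_mem hj
    exact hmem (a, j) (by rw [hl]; exact List.mem_append_left _ this)
  · intro j hj
    have : (b, j) ∈ l₂ := by rw [e2]; exact List.mem_map_of_mem hj
    exact hmem (b, j) (by rw [hl]; exact List.mem_append_right _ this)

theorem fill_freeA (hab : a ≠ b) (w : List A) : fill a b (freeA a b w) w = w := by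
  obtain ⟨P, Q, -, h, hP, -, hn, hPa, hQb⟩ := exists_unmatched_eq_append hab w
  refine List.ext_getElem? fun j => ?_
  rw [getElem?_fill, h, ← hP, List.take_left]
  by_cases h1 : j ∈ P
  · simp [h1, hPa j h1]
  · by_cases h2 : j ∈ Q
    · simp [h1, h2, hQb j h2]
    · simp [h1, h2]

/-- Each effective round removes the first `a` and the last `b`, until one kind is exhausted and the
list becomes a fixed point. Thus `P` loses letters from its front and `Q` from its end. -/
theorem cyclicCancel_iterate (hab : a ≠ b) (m : ℕ) (P Q : List ℕ) (hm : P.length ≤ m) :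
    (cyclicCancel a b)^[m] (P.map (Prod.mk a) ++ Q.map (Prod.mk b)) =
      (P.drop Q.length).map (Prod.mk a) ++ (Q.take (Q.length - P.length)).map (Prod.mk b) := by
  induction m generalizing P Q with
  | zero =>
    have : P = [] := by simpa using hm
    simp [this]
  | succ m ih =>
    rw [Function.iterate_succ_apply]
    cases P with
    | nil =>
      have h : cyclicCancel a b (Q.map (Prod.mk b)) = Q.map (Prod.mk b) := by
        rw [cyclicCancel, if_neg]
        rintro ⟨-, h⟩
        cases Q <;> simp [hab.symm] at h
      simpa [h] using ih [] Q (by simp)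
    | cons x P =>
      rcases List.eq_nil_or_concat' Q with rfl | ⟨Q, y, rfl⟩
      · have h : cyclicCancel a b ((x :: P).map (Prod.mk a)) = (x :: P).map (Prod.mk a) := by
          rw [cyclicCancel, if_neg]
          rintro ⟨h, -⟩
          rw [List.getLast?_map] at h
          simp only [List.getLast?_cons, Option.map_some, Option.some.injEq] at h
          exact hab h
        have h' : ∀ m, (cyclicCancel a b)^[m] ((x :: P).map (Prod.mk a)) =
            (x :: P).map (Prod.mk a) := fun m => Function.iterate_fixed h m
        simp only [List.map_nil, List.append_nil, List.length_nil, List.drop_zero, List.take_nil]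
        rw [h, h']
      · have h : cyclicCancel a b ((x :: P).map (Prod.mk a) ++ (Q ++ [y]).map (Prod.mk b)) =
            P.map (Prod.mk a) ++ Q.map (Prod.mk b) := by
          rw [cyclicCancel, if_pos]
          · simp [← List.append_assoc]
          · simp [List.getLast?_append, List.getLast?_cons]
        rw [h, ih P Q (by simpa using hm)]
        have e : (Q ++ [y]).length - (x :: P).length = Q.length - P.length := by simp
        rw [e, List.take_append_of_le_length (by omega)]
        simp

/-- Let p and q be the lengths of `P` and `Q`. If p > q, the last p - q unmatched `a`s become `b`s;
if q > p, the first q - p unmatched `b`s become `a`s. Either way the unmatched positions end up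
carrying a^q b^p. -/
theorem letterPerm_eq_fill (hab : a ≠ b) (w : List A) :
    letterPerm a b w = fill a b (freeB a b w) w := by
  obtain ⟨P, Q, hl, h, hP, hQ, hn, hPa, hQb⟩ := exists_unmatched_eq_append hab w
  have hu : unmatched a b w =
      (P.drop Q.length).map (Prod.mk a) ++ (Q.take (Q.length - P.length)).map (Prod.mk b) := by
    rw [unmatched, linearUnmatched_eq, hl]
    refine cyclicCancel_iterate hab _ P Q ?_
    have := freeA_add_freeB_le_length (a := a) (b := b) w
    omega
  refine List.ext_getElem? fun j => ?_
  rw [getElem?_fill, h, ← hQ, letterPerm, List.getElem?_map, List.getElem?_zipIdx]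
  rw [List.nodup_append] at hn
  obtain ⟨hnP, hnQ, hd⟩ := hn
  rcases hj : w[j]? with _ | x
  · rfl
  simp only [Option.map_some, zero_add, Option.some.injEq]
  have hmem : (x, j) ∈ unmatched a b w ↔
      j ∈ P.drop Q.length ∨ j ∈ Q.take (Q.length - P.length) := by
    rw [hu, List.mem_append, List.mem_map, List.mem_map]
    constructor
    · rintro (⟨i, hi, e⟩ | ⟨i, hi, e⟩) <;> cases e
      · exact .inl hi
      · exact .inr hi
    · rintro (hi | hi)
      · have := hPa j (List.mem_of_mem_drop hi)
        rw [hj, Option.some.injEq] at this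
        exact .inl ⟨j, hi, by rw [this]⟩
      · have := hQb j (List.mem_of_mem_take hi)
        rw [hj, Option.some.injEq] at this
        exact .inr ⟨j, hi, by rw [this]⟩
  rw [List.take_append]
  simp only [hmem, List.mem_append]
  by_cases h1 : j ∈ P
  · have hx := hPa j h1
    rw [hj, Option.some.injEq] at hx
    have h2 : j ∉ Q := fun h2 => hd j h1 j h2 rfl
    have h3 : ∀ m, j ∉ Q.take m := fun m h => h2 (List.mem_of_mem_take h)
    have h4 : j ∈ P.drop Q.length ↔ j ∉ P.take Q.length := by
      rw [← List.take_append_drop Q.length P, List.nodup_append] at hnP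
      rw [← List.take_append_drop Q.length P, List.mem_append] at h1
      constructor
      · exact fun h h' => hnP.2.2 j h' j h rfl
      · exact fun h => h1.resolve_left h
    simp only [h1, h2, h3, h4, hx, or_false, if_true]
    by_cases h5 : j ∈ P.take Q.length <;> simp [h5]
  · have h3 : ∀ m, j ∉ P.take m := fun m h => h1 (List.mem_of_mem_take h)
    have h4 : ∀ m, j ∉ P.drop m := fun m h => h1 (List.mem_of_mem_drop h)
    by_cases h2 : j ∈ Q
    · have hx := hQb j h2
      rw [hj, Option.some.injEq] at hx
      simp only [h1, h2, h3, h4, hx, false_or, if_true, if_neg hab.symm]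
    · have h5 : ∀ m, j ∉ Q.take m := fun m h => h2 (List.mem_of_mem_take h)
      simp only [h1, h2, h4, h5, false_or, if_false]

/-- The equivalence relation generated by `Raise`. -/
def SameString (a b : A) : List A → List A → Prop := Relation.EqvGen (Raise a b)

namespace SameString

theorem refl (w : List A) : SameString a b w w := Relation.EqvGen.refl w

theorem symm {w w' : List A} (h : SameString a b w w') : SameString a b w' w :=
  Relation.EqvGen.symm _ _ h

theorem trans {u v w : List A} (h : SameString a b u v) (h' : SameString a b v w) :
    SameString a b u w := Relation.EqvGen.trans _ _ _ h h'

/-- A relation that contains `Raise` and its converse and that is reflexive and transitive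
contains `SameString`. -/
theorem induction {P : List A → List A → Prop} (hrefl : ∀ w, P w w)
    (hup : ∀ w w', Raise a b w w' → P w w') (hdown : ∀ w w', Raise a b w' w → P w w')
    (htrans : ∀ u v w, P u v → P v w → P u w) {w w' : List A} (h : SameString a b w w') :
    P w w' := by
  have key : P w w' ∧ P w' w := by
    induction h with
    | rel x y h => exact ⟨hup _ _ h, hdown _ _ h⟩
    | refl x => exact ⟨hrefl x, hrefl x⟩
    | symm x y _ ih => exact ih.symm
    | trans x y z _ _ ih1 ih2 => exact ⟨htrans _ _ _ ih1.1 ih2.1, htrans _ _ _ ih2.2 ih1.2⟩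
  exact key.1

theorem fill_eq (hab : a ≠ b) {w w' : List A} (h : SameString a b w w') (n : ℕ) :
    fill a b n w = fill a b n w' :=
  induction (P := fun w w' => fill a b n w = fill a b n w') (fun _ => rfl)
    (fun _ _ h => (h.fill_eq hab n).symm) (fun _ _ h => h.fill_eq hab n)
    (fun _ _ _ => Eq.trans) h

/-- A word is recovered by filling its unmatched positions with its own number of free `a`s, and the
result of filling depends only on the string. -/
theorem eq_of_freeA_eq (hab : a ≠ b) {w w' : List A} (h : SameString a b w w')
    (h' : freeA a b w = freeA a b w') : w = w' := by
  rw [← fill_freeA hab w, ← fill_freeA hab w', ← h', h.fill_eq hab]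

end SameString

theorem fill_spec (hab : a ≠ b) (w : List A) (n : ℕ) (hn : n ≤ freeA a b w + freeB a b w) :
    SameString a b w (fill a b n w) ∧ freeA a b (fill a b n w) = n := by
  -- One of the truncated differences vanishes, so `d` is the distance from `freeA a b w` to `n`;
  -- each raise or lowering towards `n` reduces it by one.
  obtain ⟨d, hd⟩ : ∃ d, d = (n - freeA a b w) + (freeA a b w - n) := ⟨_, rfl⟩
  induction d generalizing w with
  | zero =>
    obtain rfl : n = freeA a b w := by omega
    rw [fill_freeA hab]
    exact ⟨.refl w, rfl⟩
  | succ d ih =>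
    rcases lt_or_ge n (freeA a b w) with h | h
    · obtain ⟨w', hw'⟩ := exists_raise hab (w := w) (by omega)
      have := hw'.free hab
      rw [← hw'.fill_eq hab]
      obtain ⟨h1, h2⟩ := ih w' (by omega) (by omega)
      exact ⟨.trans (.rel _ _ hw') h1, h2⟩
    · obtain ⟨w', hw'⟩ := exists_raise_to hab (w := w) (by omega)
      have := hw'.free hab
      rw [hw'.fill_eq hab]
      obtain ⟨h1, h2⟩ := ih w' (by omega) (by omega)
      exact ⟨.trans (SameString.symm (.rel _ _ hw')) h1, h2⟩

theorem sameString_letterPerm (hab : a ≠ b) (w : List A) :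
    SameString a b w (letterPerm a b w) := by
  rw [letterPerm_eq_fill hab]
  exact (fill_spec hab w _ (by omega)).1

theorem freeA_letterPerm (hab : a ≠ b) (w : List A) :
    freeA a b (letterPerm a b w) = freeB a b w := by
  rw [letterPerm_eq_fill hab]
  exact (fill_spec hab w _ (by omega)).2

/-- `letterPerm a b w` is the only word in the string of `w` with as many unmatched `a`s as `w`
has unmatched `b`s. -/
theorem SameString.eq_letterPerm (hab : a ≠ b) {w x : List A} (h : SameString a b w x)
    (hx : freeA a b x = freeB a b w) : x = letterPerm a b w :=
  (h.symm.trans (sameString_letterPerm hab w)).eq_of_freeA_eq hab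
    (by rw [hx, freeA_letterPerm hab])

end LetterPerm

/-! ### Compatibility of raising and lowering with Knuth equivalence -/

section KnuthRaise

variable {A : Type*} [LinearOrder A] {a b : A}

/-- The Knuth relations `xzy ∼ zxy` (`x ≤ y < z`) and `yxz ∼ yzx` (`x < y ≤ z`), in either
direction. -/
def KnuthRel (s t : List A) : Prop :=
  ∃ x y z, (x ≤ y ∧ y < z ∧ (s = [x, z, y] ∧ t = [z, x, y] ∨ s = [z, x, y] ∧ t = [x, z, y])) ∨
    (x < y ∧ y ≤ z ∧ (s = [y, x, z] ∧ t = [y, z, x] ∨ s = [y, z, x] ∧ t = [y, x, z]))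

theorem KnuthRel.symm {s t : List A} (h : KnuthRel s t) : KnuthRel t s := by
  obtain ⟨x, y, z, h⟩ := h
  exact ⟨x, y, z, by tauto⟩

theorem KnuthRel.free (hab : a ⋖ b) {s t : List A} (h : KnuthRel s t) :
    freeA a b s = freeA a b t ∧ freeB a b s = freeB a b t := by
  have h1 := hab.lt
  have h2 : ∀ x, a < x → b ≤ x := fun x => hab.ge_of_gt
  obtain ⟨x, y, z, ⟨hxy, hyz, ⟨rfl, rfl⟩ | ⟨rfl, rfl⟩⟩ | ⟨hxy, hyz, ⟨rfl, rfl⟩ | ⟨rfl, rfl⟩⟩⟩ := h <;>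
  · have := h2 x
    have := h2 y
    have := h2 z
    simp only [freeA, freeB]
    grind

theorem raise_triple {x y z : A} {t : List A} : Raise a b [x, y, z] t ↔
    x = a ∧ t = [b, y, z] ∧ freeA a b [y, z] = 0 ∨
    y = a ∧ t = [x, b, z] ∧ freeB a b [x] = 0 ∧ freeA a b [z] = 0 ∨
    z = a ∧ t = [x, y, b] ∧ freeB a b [x, y] = 0 := by
  constructor
  · rintro ⟨u, v, h, rfl, hu, hv⟩
    rcases u with _ | ⟨u1, _ | ⟨u2, _ | ⟨u3, u⟩⟩⟩ <;> simp at h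
    · obtain ⟨rfl, rfl⟩ := h
      simp [hv]
    · obtain ⟨rfl, rfl, rfl⟩ := h
      simp [hv, hu]
    · obtain ⟨rfl, rfl, rfl, rfl⟩ := h
      simp [hu]
  · rintro (⟨rfl, rfl, h⟩ | ⟨rfl, rfl, h, h'⟩ | ⟨rfl, rfl, h⟩)
    · exact ⟨[], _, rfl, rfl, rfl, h⟩
    · exact ⟨[x], _, rfl, rfl, h, h'⟩
    · exact ⟨[x, y], _, rfl, rfl, h, rfl⟩

theorem raise_to_triple {x y z : A} {t : List A} : Raise a b t [x, y, z] ↔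
    x = b ∧ t = [a, y, z] ∧ freeA a b [y, z] = 0 ∨
    y = b ∧ t = [x, a, z] ∧ freeB a b [x] = 0 ∧ freeA a b [z] = 0 ∨
    z = b ∧ t = [x, y, a] ∧ freeB a b [x, y] = 0 := by
  constructor
  · rintro ⟨u, v, rfl, h, hu, hv⟩
    rcases u with _ | ⟨u1, _ | ⟨u2, _ | ⟨u3, u⟩⟩⟩ <;> simp at h
    · obtain ⟨rfl, rfl⟩ := h
      simp [hv]
    · obtain ⟨rfl, rfl, rfl⟩ := h
      simp [hv, hu]
    · obtain ⟨rfl, rfl, rfl, rfl⟩ := h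
      simp [hu]
  · rintro (⟨rfl, rfl, h⟩ | ⟨rfl, rfl, h, h'⟩ | ⟨rfl, rfl, h⟩)
    · exact ⟨[], _, rfl, rfl, rfl, h⟩
    · exact ⟨[x], _, rfl, rfl, h, h'⟩
    · exact ⟨[x, y], _, rfl, rfl, h, rfl⟩

theorem KnuthRel.xzy {x y z : A} (h : x ≤ y) (h' : y < z) : KnuthRel [x, z, y] [z, x, y] :=
  ⟨x, y, z, .inl ⟨h, h', .inl ⟨rfl, rfl⟩⟩⟩

theorem KnuthRel.yxz {x y z : A} (h : x < y) (h' : y ≤ z) : KnuthRel [y, x, z] [y, z, x] :=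
  ⟨x, y, z, .inr ⟨h, h', .inl ⟨rfl, rfl⟩⟩⟩

theorem knuthRel_triple {p q r p' q' r' : A} : KnuthRel [p, q, r] [p', q', r'] ↔
    (p = q' ∧ q = p' ∧ r = r' ∧ (p ≤ r ∧ r < q ∨ q ≤ r ∧ r < p)) ∨
      (p = p' ∧ q = r' ∧ r = q' ∧ (q < p ∧ p ≤ r ∨ r < p ∧ p ≤ q)) := by
  constructor
  · rintro ⟨x, y, z, h⟩
    simp only [List.cons.injEq, and_true] at h
    grind
  · rintro (⟨rfl, rfl, rfl, h | h⟩ | ⟨rfl, rfl, rfl, h | h⟩)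
    · exact .xzy h.1 h.2
    · exact (KnuthRel.xzy h.1 h.2).symm
    · exact .yxz h.1 h.2
    · exact (KnuthRel.yxz h.1 h.2).symm

/-- A finite check on three letters, using that every letter greater than `a` is at least `b`. The
type of the relation may change: raising aba ∼ baa gives bba ∼ bab. -/
theorem KnuthRel.exists_raise (hab : a ⋖ b) {s t s' : List A} (h : KnuthRel s t)
    (hs : Raise a b s s') : ∃ t', Raise a b t t' ∧ KnuthRel s' t' := by
  have h1 := hab.lt
  have h2 : ∀ x, a < x → b ≤ x := fun x => hab.ge_of_gt
  obtain ⟨x, y, z, ⟨hxy, hyz, ⟨rfl, rfl⟩ | ⟨rfl, rfl⟩⟩ | ⟨hxy, hyz, ⟨rfl, rfl⟩ | ⟨rfl, rfl⟩⟩⟩ := h <;>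
  · have hx := h2 x
    have hy := h2 y
    have hz := h2 z
    clear h2
    rw [raise_triple] at hs
    simp only [raise_triple, or_and_right, exists_or, and_assoc, exists_and_left,
      exists_eq_left]
    rcases hs with ⟨rfl, rfl, hs⟩ | ⟨rfl, rfl, hs⟩ | ⟨rfl, rfl, hs⟩ <;>
    · simp only [knuthRel_triple, freeA, freeB] at hs ⊢
      grind

theorem KnuthRel.exists_raise_to (hab : a ⋖ b) {s t s' : List A} (h : KnuthRel s t)
    (hs : Raise a b s' s) : ∃ t', Raise a b t' t ∧ KnuthRel s' t' := by
  have h1 := hab.lt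
  have h2 : ∀ x, x < b → x ≤ a := fun x => hab.le_of_lt
  obtain ⟨x, y, z, ⟨hxy, hyz, ⟨rfl, rfl⟩ | ⟨rfl, rfl⟩⟩ | ⟨hxy, hyz, ⟨rfl, rfl⟩ | ⟨rfl, rfl⟩⟩⟩ := h <;>
  · have hx := h2 x
    have hy := h2 y
    have hz := h2 z
    clear h2
    rw [raise_to_triple] at hs
    simp only [raise_to_triple, or_and_right, exists_or, and_assoc, exists_and_left,
      exists_eq_left]
    rcases hs with ⟨rfl, rfl, hs⟩ | ⟨rfl, rfl, hs⟩ | ⟨rfl, rfl, hs⟩ <;>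
    · simp only [knuthRel_triple, freeA, freeB] at hs ⊢
      grind

namespace KnuthEquiv

theorem refl (w : List A) : KnuthEquiv w w := Relation.EqvGen.refl w

theorem symm {w w' : List A} (h : KnuthEquiv w w') : KnuthEquiv w' w := Relation.EqvGen.symm _ _ h

theorem trans {u v w : List A} (h : KnuthEquiv u v) (h' : KnuthEquiv v w) : KnuthEquiv u w :=
  Relation.EqvGen.trans _ _ _ h h'

theorem of_knuthRel {s t : List A} (h : KnuthRel s t) (u v : List A) :
    KnuthEquiv (u ++ s ++ v) (u ++ t ++ v) := by
  obtain ⟨x, y, z, ⟨h, h', ⟨rfl, rfl⟩ | ⟨rfl, rfl⟩⟩ | ⟨h, h', ⟨rfl, rfl⟩ | ⟨rfl, rfl⟩⟩⟩ := h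
  · exact .rel _ _ (.xzy u v x y z h h')
  · exact symm (.rel _ _ (.xzy u v x y z h h'))
  · exact .rel _ _ (.yxz u v x y z h h')
  · exact symm (.rel _ _ (.yxz u v x y z h h'))

theorem induction {P : List A → List A → Prop} (hrefl : ∀ w, P w w)
    (hrel : ∀ s t u v, KnuthRel s t → P (u ++ s ++ v) (u ++ t ++ v))
    (htrans : ∀ u v w, P u v → P v w → P u w)
    {w w' : List A} (h : KnuthEquiv w w') : P w w' := by
  have key : P w w' ∧ P w' w := by
    induction h with
    | rel x y h =>
      cases h with
      | xzy u v x y z h h' =>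
        exact ⟨hrel _ _ _ _ (.xzy h h'), hrel _ _ _ _ (KnuthRel.xzy h h').symm⟩
      | yxz u v x y z h h' =>
        exact ⟨hrel _ _ _ _ (.yxz h h'), hrel _ _ _ _ (KnuthRel.yxz h h').symm⟩
    | refl x => exact ⟨hrefl x, hrefl x⟩
    | symm x y _ ih => exact ih.symm
    | trans x y z _ _ ih1 ih2 => exact ⟨htrans _ _ _ ih1.1 ih2.1, htrans _ _ _ ih2.2 ih1.2⟩
  exact key.1

theorem append {u u' v v' : List A} (h : KnuthEquiv u u') (h' : KnuthEquiv v v') :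
    KnuthEquiv (u ++ v) (u' ++ v') := by
  have h1 : KnuthEquiv (u ++ v) (u' ++ v) := by
    refine induction (P := fun u u' => KnuthEquiv (u ++ v) (u' ++ v)) (fun _ => refl _)
      (fun s t p q hst => ?_) (fun _ _ _ => trans) h
    simpa using of_knuthRel hst p (q ++ v)
  have h2 : KnuthEquiv (u' ++ v) (u' ++ v') := by
    refine induction (P := fun v v' => KnuthEquiv (u' ++ v) (u' ++ v')) (fun _ => refl _)
      (fun s t p q hst => ?_) (fun _ _ _ => trans) h'
    simpa using of_knuthRel hst (u' ++ p) q
  exact h1.trans h2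

theorem free (hab : a ⋖ b) {w w' : List A} (h : KnuthEquiv w w') :
    freeA a b w = freeA a b w' ∧ freeB a b w = freeB a b w' := by
  refine induction (P := fun w w' => freeA a b w = freeA a b w' ∧ freeB a b w = freeB a b w')
    (fun _ => ⟨rfl, rfl⟩) (fun s t u v hst => ?_)
    (fun _ _ _ h h' => ⟨h.1.trans h'.1, h.2.trans h'.2⟩) h
  have := hst.free hab
  simp only [freeA_append, freeB_append, this.1, this.2, and_self]

/-- The signature rule places the raise in the prefix, the triple or the suffix. The place depends
only on counts, which agree for the two triples, so the other word is raised at the same place. -/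
theorem exists_raise (hab : a ⋖ b) {w x w' : List A} (h : KnuthEquiv w x)
    (hw : Raise a b w w') : ∃ x', Raise a b x x' ∧ KnuthEquiv w' x' := by
  revert w'
  refine induction (P := fun w x => ∀ {w'}, Raise a b w w' →
    ∃ x', Raise a b x x' ∧ KnuthEquiv w' x') (fun w w' h => ⟨w', h, refl _⟩)
    (fun s t u v hst w' hw => ?_) (fun u v w h h' x hx => ?_) h
  · have hf := hst.free hab
    rcases hw.of_append_left with ⟨y, rfl, hy, hf1⟩ | ⟨v', rfl, hv', hf1⟩
    · rcases hy.of_append_left with ⟨u', rfl, hu', hf2⟩ | ⟨s', rfl, hs', hf2⟩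
      · refine ⟨u' ++ t ++ v, (hu'.append_right ?_).append_right ?_, of_knuthRel hst _ _⟩
        · rwa [← hf.1]
        · simpa only [freeB_append, hf.1, hf.2] using hf1
      · obtain ⟨t', ht', hst'⟩ := hst.exists_raise hab hs'
        refine ⟨u ++ t' ++ v, (ht'.append_left' hab.ne ?_).append_right ?_, of_knuthRel hst' _ _⟩
        · rwa [← hf.1]
        · simpa only [freeB_append, hf.1, hf.2] using hf1
    · refine ⟨u ++ t ++ v', hv'.append_left' hab.ne ?_, of_knuthRel hst _ _⟩
      simpa only [freeB_append, hf.1, hf.2] using hf1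
  · obtain ⟨y, hy, hxy⟩ := h hx
    obtain ⟨z, hz, hyz⟩ := h' hy
    exact ⟨z, hz, hxy.trans hyz⟩

theorem exists_raise_to (hab : a ⋖ b) {w x w' : List A} (h : KnuthEquiv w x)
    (hw : Raise a b w' w) : ∃ x', Raise a b x' x ∧ KnuthEquiv w' x' := by
  revert w'
  refine induction (P := fun w x => ∀ {w'}, Raise a b w' w →
    ∃ x', Raise a b x' x ∧ KnuthEquiv w' x') (fun w w' h => ⟨w', h, refl _⟩)
    (fun s t u v hst w' hw => ?_) (fun u v w h h' x hx => ?_) h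
  · have hf := hst.free hab
    rcases hw.of_append_right hab.ne with ⟨y, rfl, hy, hf1⟩ | ⟨v', rfl, hv', hf1⟩
    · rcases hy.of_append_right hab.ne with ⟨u', rfl, hu', hf2⟩ | ⟨s', rfl, hs', hf2⟩
      · refine ⟨u' ++ t ++ v, (hu'.append_right ?_).append_right' hab.ne ?_, of_knuthRel hst _ _⟩
        · have := hu'.free hab.ne
          omega
        · simpa only [freeB_append, hf.1, hf.2] using hf1
      · obtain ⟨t', ht', hst'⟩ := hst.exists_raise_to hab hs'
        refine ⟨u ++ t' ++ v, (ht'.append_left hab.ne ?_).append_right' hab.ne ?_,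
          of_knuthRel hst' _ _⟩
        · rwa [← hf.1]
        · simpa only [freeB_append, hf.1, hf.2] using hf1
    · refine ⟨u ++ t ++ v', hv'.append_left hab.ne ?_, of_knuthRel hst _ _⟩
      simpa only [freeB_append, hf.1, hf.2] using hf1
  · obtain ⟨y, hy, hxy⟩ := h hx
    obtain ⟨z, hz, hyz⟩ := h' hy
    exact ⟨z, hz, hxy.trans hyz⟩

end KnuthEquiv

end KnuthRaise

/-! ### Locating a letter inside a concatenation or a column -/

section ListLemmas

theorem flatMap_eq_append_cons {α β : Type*} {f : α → List β} {l : List α} {u v : List β} {c : β}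
    (h : l.flatMap f = u ++ c :: v) : ∃ l₁ x l₂ s t, l = l₁ ++ x :: l₂ ∧ f x = s ++ c :: t ∧
      u = l₁.flatMap f ++ s ∧ v = t ++ l₂.flatMap f := by
  induction l generalizing u with
  | nil => simp at h
  | cons y l ih =>
    rw [List.flatMap_cons] at h
    rcases append_cons_eq_append_iff.1 h with ⟨r, h1, rfl⟩ | ⟨r, rfl, h1⟩
    · exact ⟨[], y, l, u, r, rfl, h1, rfl, rfl⟩
    · obtain ⟨l₁, x, l₂, s, t, rfl, h2, rfl, rfl⟩ := ih h1
      exact ⟨y :: l₁, x, l₂, s, t, rfl, h2, by simp, rfl⟩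

theorem filterMap_eq_append_cons {α β : Type*} {f : α → Option β} {l : List α} {u v : List β}
    {c : β} (h : l.filterMap f = u ++ c :: v) : ∃ l₁ x l₂, l = l₁ ++ x :: l₂ ∧ f x = some c ∧
      u = l₁.filterMap f ∧ v = l₂.filterMap f := by
  induction l generalizing u with
  | nil => simp at h
  | cons y l ih =>
    rcases hy : f y with _ | d
    · rw [List.filterMap_cons_none hy] at h
      obtain ⟨l₁, x, l₂, rfl, h2, rfl, rfl⟩ := ih h
      exact ⟨y :: l₁, x, l₂, rfl, h2, by rw [List.filterMap_cons_none hy], rfl⟩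
    · rw [List.filterMap_cons_some hy] at h
      cases u with
      | nil =>
        simp only [List.nil_append, List.cons.injEq] at h
        exact ⟨[], y, l, rfl, by rw [hy, h.1], rfl, h.2.symm⟩
      | cons e u =>
        simp only [List.cons_append, List.cons.injEq] at h
        obtain ⟨l₁, x, l₂, rfl, h2, rfl, rfl⟩ := ih h.2
        exact ⟨y :: l₁, x, l₂, rfl, h2, by rw [List.filterMap_cons_some hy, h.1], rfl⟩

theorem exists_eq_append_cons_of_getElem? {α : Type*} {l : List α} {j : ℕ} {c : α}
    (h : l[j]? = some c) : ∃ s t, l = s ++ c :: t ∧ s.length = j := by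
  obtain ⟨hj, rfl⟩ := List.getElem?_eq_some_iff.1 h
  exact ⟨l.take j, l.drop (j + 1), by simp, by simp; omega⟩

theorem getElem?_append_cons_of_ne {α : Type*} {s t : List α} {c : α} (d : α) {j : ℕ}
    (h : j ≠ s.length) : (s ++ c :: t)[j]? = (s ++ d :: t)[j]? := by
  rcases lt_or_gt_of_ne h with h | h
  · rw [List.getElem?_append_left h, List.getElem?_append_left h]
  · obtain ⟨m, rfl⟩ : ∃ m, j = s.length + 1 + m := ⟨j - s.length - 1, by omega⟩
    rw [List.getElem?_append_right (by omega), List.getElem?_append_right (by omega),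
      show s.length + 1 + m - s.length = m + 1 by omega]
    simp

end ListLemmas

/-! ### Comparison of adjacent rows after changing one letter -/

section Rows

variable {A : Type*} [LinearOrder A] {a b : A}

theorem RowGt.trans {r s t : List A} (h : RowGt r s) (h' : RowGt s t) : RowGt r t :=
  ⟨h.1.trans h'.1, fun i hr ht => (h'.2 i (hr.trans_le h.1) ht).trans (h.2 i hr _)⟩

instance : IsTrans (List A) RowGt := ⟨fun _ _ _ => RowGt.trans⟩

theorem RowGt.getElem? {s t : List A} (h : RowGt s t) {j : ℕ} {x : A} (hx : s[j]? = some x) :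
    ∃ y, t[j]? = some y ∧ y < x := by
  obtain ⟨hj, rfl⟩ := List.getElem?_eq_some_iff.1 hx
  exact ⟨t[j]'(hj.trans_le h.1), List.getElem?_eq_getElem _, h.2 j hj _⟩

theorem RowGt.replace_left {s t q : List A} {x y : A} (h : RowGt (s ++ x :: t) q)
    (hy : ∀ z, q[s.length]? = some z → z < y) : RowGt (s ++ y :: t) q := by
  induction s generalizing q with
  | nil =>
    cases q with
    | nil => exact absurd h not_rowGt_cons_nil
    | cons z q => exact rowGt_cons.2 ⟨hy z rfl, (rowGt_cons.1 h).2⟩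
  | cons w s ih =>
    cases q with
    | nil => exact absurd h not_rowGt_cons_nil
    | cons z q =>
      rw [List.cons_append, rowGt_cons] at h ⊢
      exact ⟨h.1, ih h.2 fun z hz => hy z (by simpa using hz)⟩

theorem RowGt.replace_right {s t p : List A} {x y : A} (h : RowGt p (s ++ x :: t))
    (hy : ∀ z, p[s.length]? = some z → y < z) : RowGt p (s ++ y :: t) := by
  induction s generalizing p with
  | nil =>
    cases p with
    | nil => exact rowGt_nil _
    | cons z p => exact rowGt_cons.2 ⟨hy z rfl, (rowGt_cons.1 h).2⟩
  | cons w s ih =>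
    cases p with
    | nil => exact rowGt_nil _
    | cons z p =>
      rw [List.cons_append, rowGt_cons] at h ⊢
      exact ⟨h.1, ih h.2 fun z hz => hy z (by simpa using hz)⟩

theorem RowGt.raise_left {s t q : List A} {x y : A} (h : RowGt (s ++ x :: t) q) (hxy : x ≤ y) :
    RowGt (s ++ y :: t) q := by
  refine h.replace_left fun z hz => ?_
  obtain ⟨w, hw, hwx⟩ := h.getElem? (j := s.length) (x := x) (by simp)
  rw [hz, Option.some.injEq] at hw
  exact hw ▸ hwx.trans_le hxy

theorem RowGt.lower_right {s t p : List A} {x y : A} (h : RowGt p (s ++ x :: t)) (hyx : y ≤ x) :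
    RowGt p (s ++ y :: t) := by
  refine h.replace_right fun z hz => ?_
  obtain ⟨w, hw, hwz⟩ := h.getElem? hz
  simp only [List.getElem?_append_right le_rfl, Nat.sub_self, List.getElem?_cons_zero,
    Option.some.injEq] at hw
  exact hyx.trans_lt (hw ▸ hwz)

/-- A row remains below another one when its last unmatched `a` is changed into `b`. -/
theorem RowGt.raise_right (hab : a ⋖ b) {p s t : List A} (hp : p.Pairwise (· ≤ ·))
    (hs : ∀ x ∈ s, x ≤ a) (h : RowGt p (s ++ a :: t)) (h0 : freeB a b (p ++ s) = 0) :
    RowGt p (s ++ b :: t) := by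
  induction s generalizing p with
  | nil =>
    cases p with
    | nil => exact rowGt_nil _
    | cons x p =>
      rw [List.nil_append, rowGt_cons] at h
      refine rowGt_cons.2 ⟨lt_of_le_of_ne (hab.ge_of_gt h.1) ?_, h.2⟩
      rintro rfl
      rw [List.append_nil] at h0
      refine (freeB_pos_of_mem hab.ne List.mem_cons_self ?_).ne' h0
      rw [List.pairwise_cons] at hp
      rintro (_ | ⟨_, hm⟩)
      · exact h.1.false
      · exact (hp.1 a hm).not_gt hab.lt
  | cons y s ih =>
    cases p with
    | nil => exact rowGt_nil _
    | cons x p =>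
      rw [List.cons_append, rowGt_cons] at h ⊢
      rw [List.pairwise_cons] at hp
      simp only [List.mem_cons, forall_eq_or_imp] at hs
      refine ⟨h.1, ih hp.2 hs.2 h.2 ?_⟩
      have h1 : freeB a b (p ++ y :: s) = 0 := by
        rw [List.cons_append, ← List.singleton_append, freeB_append] at h0
        omega
      rcases hs.1.lt_or_eq with hy | rfl
      · rw [freeB_append] at h1 ⊢
        rwa [freeA_cons_of_ne hy.ne (hy.trans hab.lt).ne,
          freeB_cons_of_ne hy.ne (hy.trans hab.lt).ne] at h1
      -- The deleted column has `a` below `x`. If `x = b`, it contributes one free `b` to the upper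
      -- row and one free `a` to the lower, and these cancel; if `x > b`, the rest of the upper row
      -- contains no `b`.
      · have hbx := hab.ge_of_gt h.1
        have hpy : y ∉ p := fun hm => (hp.1 y hm).not_gt h.1
        rw [freeB_append] at h0 ⊢
        rw [freeA_cons_left, freeB_cons_left] at h0
        rcases hbx.eq_or_lt with rfl | hbx
        · rw [freeB_cons_right hab.ne, freeA_eq_zero_of_notMem hpy] at h0
          omega
        · rw [freeB_eq_zero_of_notMem (w := p) fun hm => (hp.1 b hm).not_gt hbx]
          omega

/-- The `b`s form an initial segment of `p`, and each of them has an `a` directly below it, the only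
possible letter there. -/
theorem RowGt.freeB_le_freeA (hab : a ⋖ b) {p q : List A} (hp : p.Pairwise (· ≤ ·))
    (hpb : ∀ x ∈ p, b ≤ x) (hq : ∀ x ∈ q, a ≤ x) (h : RowGt p q) :
    freeB a b p ≤ freeA a b q := by
  induction p generalizing q with
  | nil => simp
  | cons x p ih =>
    cases q with
    | nil => exact absurd h not_rowGt_cons_nil
    | cons y q =>
      rw [rowGt_cons] at h
      rw [List.pairwise_cons] at hp
      simp only [List.mem_cons, forall_eq_or_imp] at hpb hq
      rcases hpb.1.eq_or_lt with rfl | hx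
      · obtain rfl : a = y := le_antisymm hq.1 (hab.le_of_lt h.1)
        have := ih hp.2 hpb.2 hq.2 h.2
        rw [freeB_cons_right hab.ne, freeA_cons_left]
        omega
      · rw [freeB_eq_zero_of_notMem]
        · omega
        · rintro (_ | ⟨_, hm⟩)
          · exact hx.false
          · exact (hp.1 b hm).not_gt hx

/-- A row remains above another one when its first unmatched `b` is changed into `a`. -/
theorem RowGt.lower_left (hab : a ⋖ b) {s t q : List A} (hq : q.Pairwise (· ≤ ·))
    (hs : (s ++ b :: t).Pairwise (· ≤ ·)) (h : RowGt (s ++ b :: t) q)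
    (h0 : freeA a b (t ++ q) = 0) : RowGt (s ++ a :: t) q := by
  induction s generalizing q with
  | nil =>
    cases q with
    | nil => exact absurd h not_rowGt_cons_nil
    | cons y q =>
      rw [List.nil_append, rowGt_cons] at h
      rw [List.nil_append, List.pairwise_cons] at hs
      rw [List.pairwise_cons] at hq
      refine rowGt_cons.2 ⟨lt_of_le_of_ne (hab.le_of_lt h.1) ?_, h.2⟩
      rintro rfl
      -- With `a` below the modified `b`, the lower row would have one more free `a` than the free
      -- `b`s of `t` can absorb.
      have := h.2.freeB_le_freeA hab hs.2 hs.1 hq.1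
      rw [freeA_append, freeA_cons_left] at h0
      omega
  | cons x s ih =>
    cases q with
    | nil => exact absurd h not_rowGt_cons_nil
    | cons y q =>
      rw [List.cons_append, rowGt_cons] at h ⊢
      rw [List.cons_append, List.pairwise_cons] at hs
      rw [List.pairwise_cons] at hq
      refine ⟨h.1, ih hq.2 hs.2 h.2 ?_⟩
      have hya : y ≤ a := hab.le_of_lt (h.1.trans_le (hs.1 b (by simp)))
      rw [freeA_append] at h0 ⊢
      rcases hya.eq_or_lt with rfl | hy
      · rw [freeA_cons_left] at h0
        omega
      · rwa [freeA_cons_of_ne hy.ne (hy.trans hab.lt).ne] at h0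

end Rows

/-! ### Readings of tableaux of a fixed shape are stable under raising and lowering -/

namespace YoungTableau

variable {A : Type*} [LinearOrder A] {a b : A}

theorem pairwise_rows (T : YoungTableau A) : T.rows.Pairwise RowGt :=
  List.isChain_iff_pairwise.1 T.rows_decreasing

theorem numCols_eq (T : YoungTableau A) : T.numCols = T.shape.getLast?.getD 0 := by
  rw [numCols, shape, List.getLast?_map]
  cases T.rows.getLast? <;> rfl

theorem length_le_numCols (T : YoungTableau A) {r : List A} (hr : r ∈ T.rows) :
    r.length ≤ T.numCols := by
  have h := T.pairwise_rows
  rw [numCols]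
  rcases List.eq_nil_or_concat' T.rows with h' | ⟨R, q, h'⟩
  · simp [h'] at hr
  · rw [h'] at h hr ⊢
    rw [List.pairwise_append] at h
    simp only [List.getLast?_append, List.getLast?_singleton, Option.some_or, Option.getD_some]
    rcases List.mem_append.1 hr with hr | hr
    · exact (h.2.2 r hr q (by simp)).1
    · rw [List.mem_singleton.1 hr]

theorem exists_replace (T : YoungTableau A) {R₁ R₂ : List (List A)} {s t : List A} {x y : A}
    (h : T.rows = R₁ ++ (s ++ x :: t) :: R₂) (hs : (s ++ y :: t).Pairwise (· ≤ ·))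
    (h1 : ∀ r ∈ R₁, RowGt r (s ++ y :: t)) (h2 : ∀ r ∈ R₂, RowGt (s ++ y :: t) r) :
    ∃ T' : YoungTableau A, T'.rows = R₁ ++ (s ++ y :: t) :: R₂ ∧ T'.shape = T.shape := by
  have h3 := T.pairwise_rows
  have h4 := T.rows_ne_nil
  have h5 := T.rows_sorted
  rw [h] at h3 h4 h5
  simp only [List.mem_append, List.mem_cons, List.pairwise_append, List.pairwise_cons] at h3 h4 h5
  refine ⟨⟨R₁ ++ (s ++ y :: t) :: R₂, ?_, ?_, ?_⟩, rfl, ?_⟩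
  · intro r hr
    simp only [List.mem_append, List.mem_cons] at hr
    rcases hr with hr | rfl | hr
    · exact h4 r (.inl hr)
    · simp
    · exact h4 r (.inr (.inr hr))
  · intro r hr
    simp only [List.mem_append, List.mem_cons] at hr
    rcases hr with hr | rfl | hr
    · exact h5 r (.inl hr)
    · exact hs
    · exact h5 r (.inr (.inr hr))
  · refine List.isChain_iff_pairwise.2 (List.pairwise_append.2 ⟨h3.1, List.pairwise_cons.2
      ⟨h2, h3.2.1.2⟩, fun r hr q hq => ?_⟩)
    rcases List.mem_cons.1 hq with rfl | hq
    · exact h1 r hr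
    · exact h3.2.2 r hr q (.inr hq)
  · simp [shape, h]

/-- An `a` immediately to the right would be a later unmatched `a`, so the row stays non-decreasing.
The row above is handled by `RowGt.raise_right`, and the rows below only benefit from a larger
letter. -/
theorem exists_raise_rowReading (hab : a ⋖ b) (T : YoungTableau A) {w : List A}
    (h : Raise a b T.rowReading w) : ∃ T' : YoungTableau A, T'.shape = T.shape ∧
      T'.rowReading = w := by
  obtain ⟨u, v, h, rfl, hu, hv⟩ := h
  rw [rowReading, ← List.flatMap_id] at h
  obtain ⟨R₁, r, R₂, s, t, hR, rfl, rfl, rfl⟩ := flatMap_eq_append_cons h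
  have hp := T.pairwise_rows
  have hsort := T.rows_sorted
  rw [hR] at hp hsort
  simp only [List.mem_cons, List.pairwise_append, List.pairwise_cons] at hp
  have hst := hsort (s ++ a :: t) (by simp)
  rw [List.pairwise_append, List.pairwise_cons] at hst
  simp only [List.mem_cons] at hst
  have hsa : ∀ x ∈ s, x ≤ a := fun x hx => hst.2.2 x hx a (.inl rfl)
  have htb : ∀ x ∈ t, b ≤ x := by
    rw [freeA_append] at hv
    cases t with
    | nil => simp
    | cons y t =>
      have hy : a < y := by
        refine lt_of_le_of_ne (hst.2.1.1 y (by simp)) ?_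
        rintro rfl
        simp at hv
      have hy := hab.ge_of_gt hy
      have h1 := (List.pairwise_cons.1 hst.2.1.2).1
      intro x hx
      rcases List.mem_cons.1 hx with rfl | hx
      · exact hy
      · exact hy.trans (h1 x hx)
  have hT1 : (s ++ b :: t).Pairwise (· ≤ ·) := by
    rw [List.pairwise_append, List.pairwise_cons]
    refine ⟨hst.1, ⟨htb, hst.2.1.2⟩, fun x hx y hy => ?_⟩
    rcases List.mem_cons.1 hy with rfl | hy
    · exact (hsa x hx).trans hab.le
    · exact hst.2.2 x hx y (.inr hy)
  have hT2 : ∀ r ∈ R₁, RowGt r (s ++ b :: t) := by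
    -- By transitivity only the row directly above matters; it is read just before this row, so no
    -- free `b` remains in its concatenation with `s`.
    rcases List.eq_nil_or_concat' R₁ with rfl | ⟨R, q, rfl⟩
    · simp
    · have hq : RowGt q (s ++ b :: t) := by
        refine RowGt.raise_right hab (hsort q (by simp)) hsa
          (hp.2.2 q (by simp) _ (.inl rfl)) ?_
        rw [List.flatMap_append, List.append_assoc, freeB_append] at hu
        simp only [List.flatMap_cons, List.flatMap_nil, List.append_nil, id_eq] at hu
        omega
      intro r hr
      rcases List.mem_append.1 hr with hr | hr
      · exact ((List.pairwise_append.1 hp.1).2.2 r hr q (by simp)).trans hq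
      · rw [List.mem_singleton.1 hr]
        exact hq
  have hT3 : ∀ r ∈ R₂, RowGt (s ++ b :: t) r := by
    exact fun r hr => (hp.2.1.1 r hr).raise_left hab.le
  obtain ⟨T', hT', hsh⟩ := T.exists_replace hR hT1 hT2 hT3
  exact ⟨T', hsh, by simp [rowReading, hT', List.flatMap_id]⟩

/-- A `b` to the left in the same row would be an earlier unmatched `b`. The row directly below is
handled by `RowGt.lower_left`, and the rows above only benefit from a smaller letter. -/
theorem exists_lower_rowReading (hab : a ⋖ b) (T : YoungTableau A) {w : List A}
    (h : Raise a b w T.rowReading) : ∃ T' : YoungTableau A, T'.shape = T.shape ∧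
      T'.rowReading = w := by
  obtain ⟨u, v, rfl, h, hu, hv⟩ := h
  rw [rowReading, ← List.flatMap_id] at h
  obtain ⟨R₁, r, R₂, s, t, hR, rfl, rfl, rfl⟩ := flatMap_eq_append_cons h
  have hp := T.pairwise_rows
  have hsort := T.rows_sorted
  rw [hR] at hp hsort
  simp only [List.mem_cons, List.pairwise_append, List.pairwise_cons] at hp
  have hst' := hsort (s ++ b :: t) (by simp)
  have hst := hst'
  rw [List.pairwise_append, List.pairwise_cons] at hst
  simp only [List.mem_cons] at hst
  have htb : ∀ x ∈ t, b ≤ x := hst.2.1.1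
  have hsa : ∀ x ∈ s, x ≤ a := by
    intro x hx
    refine hab.le_of_lt (lt_of_le_of_ne (hst.2.2 x hx b (.inl rfl)) ?_)
    rintro rfl
    obtain ⟨s₁, s₂, rfl⟩ := List.append_of_mem hx
    rw [← List.append_assoc, freeB_append] at hu
    have h1 := (List.pairwise_cons.1 (List.pairwise_append.1 hst.1).2.1).1
    have : 0 < freeB a x (x :: s₂) := by
      refine freeB_pos_of_mem hab.ne (by simp) ?_
      rintro (_ | ⟨_, hm⟩)
      · exact hab.lt.false
      · exact (h1 a hm).not_gt hab.lt
    omega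
  have hT1 : (s ++ a :: t).Pairwise (· ≤ ·) := by
    rw [List.pairwise_append, List.pairwise_cons]
    refine ⟨hst.1, ⟨fun x hx => hab.le.trans (htb x hx), hst.2.1.2⟩, fun x hx y hy => ?_⟩
    rcases List.mem_cons.1 hy with rfl | hy
    · exact hsa x hx
    · exact hst.2.2 x hx y (.inr hy)
  have hT2 : ∀ r ∈ R₁, RowGt r (s ++ a :: t) := by
    exact fun r hr => (hp.2.2 r hr _ (.inl rfl)).lower_right hab.le
  have hT3 : ∀ r ∈ R₂, RowGt (s ++ a :: t) r := by
    cases R₂ with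
    | nil => simp
    | cons q R =>
      have hq : RowGt (s ++ a :: t) q := by
        refine RowGt.lower_left hab (hsort q (by simp)) hst' (hp.2.1.1 q (by simp)) ?_
        rw [List.flatMap_cons, ← List.append_assoc, freeA_append] at hv
        simp only [id_eq] at hv
        omega
      intro r hr
      rcases List.mem_cons.1 hr with rfl | hr
      · exact hq
      · exact hq.trans ((List.pairwise_cons.1 hp.2.1.2).1 r hr)
  obtain ⟨T', hT', hsh⟩ := T.exists_replace hR hT1 hT2 hT3
  exact ⟨T', hsh, by simp [rowReading, hT', List.flatMap_id]⟩

theorem colReading_replace {T T' : YoungTableau A} {R₁ R₂ : List (List A)} {s t : List A}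
    {x y : A} (h : T.rows = R₁ ++ (s ++ x :: t) :: R₂)
    (h' : T'.rows = R₁ ++ (s ++ y :: t) :: R₂) (hsh : T'.shape = T.shape)
    {J₁ J₂ : List ℕ} (hJ : List.range T.numCols = J₁ ++ s.length :: J₂) :
    T'.colReading = J₁.flatMap T.column ++ R₁.filterMap (fun r => r[s.length]?) ++
      y :: (R₂.filterMap (fun r => r[s.length]?) ++ J₂.flatMap T.column) := by
  have hne : ∀ j, j ≠ s.length → T'.column j = T.column j := by
    intro j hj
    simp only [column, h, h', List.filterMap_append, List.filterMap_cons,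
      getElem?_append_cons_of_ne x hj]
  have hn : (List.range T.numCols).Nodup := List.nodup_range
  rw [hJ, List.nodup_append] at hn
  have h1 : J₁.flatMap T'.column = J₁.flatMap T.column :=
    List.flatMap_congr fun j hj => hne j fun e => hn.2.2 j hj _ (by simp) e
  have h2 : J₂.flatMap T'.column = J₂.flatMap T.column :=
    List.flatMap_congr fun j hj => hne j fun e => (List.nodup_cons.1 hn.2.1).1 (e ▸ hj)
  have h3 : T'.column s.length = R₁.filterMap (fun r => r[s.length]?) ++
      y :: R₂.filterMap (fun r => r[s.length]?) := by
    simp [column, h']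
  rw [colReading, numCols_eq, hsh, ← numCols_eq, hJ, List.flatMap_append, List.flatMap_cons, h1,
    h2, h3]
  simp

/-- The place of a letter in the column reading: it is the letter after `s` in a row. -/
theorem exists_of_colReading_eq (T : YoungTableau A) {u v : List A} {c : A}
    (h : T.colReading = u ++ c :: v) : ∃ R₁ R₂ s t J₁ J₂, T.rows = R₁ ++ (s ++ c :: t) :: R₂ ∧
      List.range T.numCols = J₁ ++ s.length :: J₂ ∧
      u = J₁.flatMap T.column ++ R₁.filterMap (fun r => r[s.length]?) ∧
      v = R₂.filterMap (fun r => r[s.length]?) ++ J₂.flatMap T.column := by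
  obtain ⟨J₁, j, J₂, c₁, c₂, hJ, hc, rfl, rfl⟩ := flatMap_eq_append_cons h
  obtain ⟨R₁, r, R₂, hR, hr, rfl, rfl⟩ := filterMap_eq_append_cons hc
  obtain ⟨s, t, rfl, rfl⟩ := exists_eq_append_cons_of_getElem? hr
  exact ⟨R₁, R₂, s, t, J₁, J₂, hR, hJ, rfl, rfl⟩

theorem range_eq_append_cons {n j : ℕ} {J₁ J₂ : List ℕ} (h : List.range n = J₁ ++ j :: J₂) :
    J₁ = List.range j ∧ J₂ = List.range' (j + 1) (n - (j + 1)) := by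
  have hl := congrArg List.length h
  simp only [List.length_range, List.length_append, List.length_cons] at hl
  have hj : J₁.length = j := by
    have := congrArg (fun l => l[J₁.length]?) h
    simpa [List.getElem?_range (show J₁.length < n by omega)] using this
  have h' : List.range n = List.range j ++ j :: List.range' (j + 1) (n - (j + 1)) := by
    rw [List.range_eq_range', List.range_eq_range', ← List.range'_succ]
    have h1 := List.range'_append_1 (s := 0) (m := j) (n := n - (j + 1) + 1)
    rw [Nat.zero_add] at h1
    rw [h1]
    congr 1
    omega
  rw [h'] at h
  obtain ⟨h1, h2⟩ := List.append_inj h.symm (by simp [hj])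
  exact ⟨h1, (List.cons.inj h2).2⟩

theorem exists_le_of_getElem?_succ {r : List A} (h : r.Pairwise (· ≤ ·)) {j : ℕ} {x : A}
    (hx : r[j + 1]? = some x) : ∃ y, r[j]? = some y ∧ y ≤ x := by
  obtain ⟨hj, rfl⟩ := List.getElem?_eq_some_iff.1 hx
  exact ⟨r[j], List.getElem?_eq_getElem _, List.pairwise_iff_getElem.1 h j (j + 1) _ hj (by omega)⟩

/-- A `b` above in the column would be free before the modified `a`. An `a` to its right would be
free after it: between the two are read only letters below the first, less than `a`, and letters
above the second, greater than `b`. -/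
theorem exists_raise_colReading (hab : a ⋖ b) (T : YoungTableau A) {w : List A}
    (h : Raise a b T.colReading w) : ∃ T' : YoungTableau A, T'.shape = T.shape ∧
      T'.colReading = w := by
  obtain ⟨u, v, h, rfl, hu, hv⟩ := h
  obtain ⟨R₁, R₂, s, t, J₁, J₂, hR, hJ, rfl, rfl⟩ := T.exists_of_colReading_eq h
  have hp := T.pairwise_rows
  have hsort := T.rows_sorted
  rw [hR] at hp hsort
  simp only [List.mem_cons, List.pairwise_append, List.pairwise_cons] at hp
  have hst := hsort (s ++ a :: t) (by simp)
  rw [List.pairwise_append, List.pairwise_cons] at hst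
  simp only [List.mem_cons] at hst
  have hs0 : (s ++ a :: t)[s.length]? = some a := by simp
  -- the letters above the modified one exceed `b`
  have hc₁a : ∀ r ∈ R₁, ∀ x, r[s.length]? = some x → a < x := by
    intro r hr x hx
    obtain ⟨y, hy, hyx⟩ := (hp.2.2 r hr _ (.inl rfl)).getElem? hx
    rw [hs0, Option.some.injEq] at hy
    exact hy ▸ hyx
  have hc₁ : ∀ r ∈ R₁, ∀ x, r[s.length]? = some x → b < x := by
    intro r hr x hx
    refine lt_of_le_of_ne (hab.ge_of_gt (hc₁a r hr x hx)) ?_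
    rintro rfl
    have h1 : 0 < freeB a b (R₁.filterMap fun r => r[s.length]?) := by
      refine freeB_pos_of_mem hab.ne (List.mem_filterMap.2 ⟨r, hr, hx⟩) fun hm => ?_
      obtain ⟨r', hr', hx'⟩ := List.mem_filterMap.1 hm
      exact (hc₁a r' hr' a hx').false
    rw [freeB_append] at hu
    omega
  -- the letter to the right of the modified one is not `a`
  have htb : ∀ x ∈ t, b ≤ x := by
    cases t with
    | nil => simp
    | cons y t =>
      have hy : a < y := by
        refine lt_of_le_of_ne (hst.2.1.1 y (by simp)) ?_
        rintro rfl
        have hlen := T.length_le_numCols (r := s ++ a :: a :: t) (by rw [hR]; simp)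
        simp only [List.length_append, List.length_cons] at hlen
        obtain ⟨-, hJ₂⟩ := range_eq_append_cons hJ
        obtain ⟨m, hm⟩ : ∃ m, T.numCols - (s.length + 1) = m + 1 :=
          ⟨T.numCols - (s.length + 1) - 1, by omega⟩
        rw [hm, List.range'_succ] at hJ₂
        have hcol : T.column (s.length + 1) = R₁.filterMap (fun r => r[s.length + 1]?) ++
            a :: R₂.filterMap (fun r => r[s.length + 1]?) := by
          simp [column, hR]
        rw [hJ₂, List.flatMap_cons, hcol, List.append_assoc, ← List.append_assoc, freeA_append,
          List.cons_append, freeA_cons_left, freeB_append, freeB_eq_zero_of_notMem (a := a),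
          freeB_eq_zero_of_notMem (a := a)] at hv
        · omega
        · intro hm
          obtain ⟨r, hr, hx⟩ := List.mem_filterMap.1 hm
          obtain ⟨y, hy, hyx⟩ := (hp.2.1.1 r hr).getElem? hs0
          rw [hx, Option.some.injEq] at hy
          exact (hy ▸ hyx).not_ge hab.le
        · intro hm
          obtain ⟨r, hr, hx⟩ := List.mem_filterMap.1 hm
          obtain ⟨y, hy, hyx⟩ := exists_le_of_getElem?_succ (hsort r (by simp [hr])) hx
          exact (hc₁ r hr y hy).not_ge hyx
      have hy := hab.ge_of_gt hy
      have h1 := (List.pairwise_cons.1 hst.2.1.2).1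
      intro x hx
      rcases List.mem_cons.1 hx with rfl | hx
      · exact hy
      · exact hy.trans (h1 x hx)
  have hT1 : (s ++ b :: t).Pairwise (· ≤ ·) := by
    rw [List.pairwise_append, List.pairwise_cons]
    refine ⟨hst.1, ⟨htb, hst.2.1.2⟩, fun x hx y hy => ?_⟩
    rcases List.mem_cons.1 hy with rfl | hy
    · exact (hst.2.2 x hx a (.inl rfl)).trans hab.le
    · exact hst.2.2 x hx y (.inr hy)
  have hT2 : ∀ r ∈ R₁, RowGt r (s ++ b :: t) := by
    exact fun r hr => (hp.2.2 r hr _ (.inl rfl)).replace_right (hc₁ r hr)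
  have hT3 : ∀ r ∈ R₂, RowGt (s ++ b :: t) r := by
    exact fun r hr => (hp.2.1.1 r hr).raise_left hab.le
  obtain ⟨T', hT', hsh⟩ := T.exists_replace hR hT1 hT2 hT3
  exact ⟨T', hsh, colReading_replace hR hT' hsh hJ⟩

/-- An `a` below in the column would be free after the modified `b`. A `b` to its left would be free
before it, since no `a` is read between the two. -/
theorem exists_lower_colReading (hab : a ⋖ b) (T : YoungTableau A) {w : List A}
    (h : Raise a b w T.colReading) : ∃ T' : YoungTableau A, T'.shape = T.shape ∧
      T'.colReading = w := by
  obtain ⟨u, v, rfl, h, hu, hv⟩ := h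
  obtain ⟨R₁, R₂, s, t, J₁, J₂, hR, hJ, rfl, rfl⟩ := T.exists_of_colReading_eq h
  have hp := T.pairwise_rows
  have hsort := T.rows_sorted
  rw [hR] at hp hsort
  simp only [List.mem_cons, List.pairwise_append, List.pairwise_cons] at hp
  have hst := hsort (s ++ b :: t) (by simp)
  rw [List.pairwise_append, List.pairwise_cons] at hst
  simp only [List.mem_cons] at hst
  have hs0 : (s ++ b :: t)[s.length]? = some b := by simp
  have hc₁ : ∀ r ∈ R₁, ∀ x, r[s.length]? = some x → b < x := by
    intro r hr x hx
    obtain ⟨y, hy, hyx⟩ := (hp.2.2 r hr _ (.inl rfl)).getElem? hx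
    rw [hs0, Option.some.injEq] at hy
    exact hy ▸ hyx
  have hc₂b : ∀ r ∈ R₂, ∀ x, r[s.length]? = some x → x < b := by
    intro r hr x hx
    obtain ⟨y, hy, hyx⟩ := (hp.2.1.1 r hr).getElem? hs0
    rw [hx, Option.some.injEq] at hy
    exact hy ▸ hyx
  -- the letters below the modified one are less than `a`
  have hc₂ : ∀ r ∈ R₂, ∀ x, r[s.length]? = some x → x < a := by
    intro r hr x hx
    refine lt_of_le_of_ne (hab.le_of_lt (hc₂b r hr x hx)) ?_
    rintro rfl
    have h1 : 0 < freeA x b (R₂.filterMap fun r => r[s.length]?) := by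
      refine freeA_pos_of_mem (List.mem_filterMap.2 ⟨r, hr, hx⟩) fun hm => ?_
      obtain ⟨r', hr', hx'⟩ := List.mem_filterMap.1 hm
      exact (hc₂b r' hr' b hx').false
    rw [freeA_append] at hv
    omega
  -- the letter to the left of the modified one is not `b`
  have hsa : ∀ x ∈ s, x ≤ a := by
    rcases List.eq_nil_or_concat' s with rfl | ⟨s, y, rfl⟩
    · simp
    have hyb : y < b := by
      refine lt_of_le_of_ne (hst.2.2 y (by simp) b (.inl rfl)) ?_
      rintro rfl
      have hJ₁ := (range_eq_append_cons hJ).1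
      have hlen : (s ++ [y]).length = s.length + 1 := by simp
      rw [hlen] at hJ₁ hc₁ hc₂ hu
      have hcol : T.column s.length = R₁.filterMap (fun r => r[s.length]?) ++
          y :: R₂.filterMap (fun r => r[s.length]?) := by
        simp [column, hR]
      have h1 : freeA a y (R₁.filterMap fun r => r[s.length + 1]?) = 0 := by
        refine freeA_eq_zero_of_notMem fun hm => ?_
        obtain ⟨r, hr, hx⟩ := List.mem_filterMap.1 hm
        exact (hc₁ r hr a hx).not_gt hab.lt
      have h2 : freeA a y (R₂.filterMap fun r => r[s.length]?) = 0 := by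
        refine freeA_eq_zero_of_notMem fun hm => ?_
        obtain ⟨r, hr, hx⟩ := List.mem_filterMap.1 hm
        have hl : s.length + 1 < r.length := by
          have := (hp.2.1.1 r hr).1
          simp only [List.length_append, List.length_cons] at this
          omega
        have hz := List.getElem?_eq_getElem hl
        obtain ⟨x, hx', hxz⟩ := exists_le_of_getElem?_succ (hsort r (by simp [hr])) hz
        rw [hx, Option.some.injEq] at hx'
        exact (hc₂ r hr _ hz).not_ge (hx' ▸ hxz)
      rw [hJ₁, List.range_succ, List.flatMap_append, List.flatMap_cons, List.flatMap_nil,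
        List.append_nil, hcol, freeB_append, freeB_append, freeB_append, h1,
        freeB_cons_right hab.ne, h2] at hu
      omega
    intro x hx
    rcases List.mem_append.1 hx with hx | hx
    · exact ((List.pairwise_append.1 hst.1).2.2 x hx y (by simp)).trans (hab.le_of_lt hyb)
    · rw [List.mem_singleton.1 hx]
      exact hab.le_of_lt hyb
  have hT1 : (s ++ a :: t).Pairwise (· ≤ ·) := by
    rw [List.pairwise_append, List.pairwise_cons]
    refine ⟨hst.1, ⟨fun x hx => hab.le.trans (hst.2.1.1 x hx), hst.2.1.2⟩, fun x hx y hy => ?_⟩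
    rcases List.mem_cons.1 hy with rfl | hy
    · exact hsa x hx
    · exact hst.2.2 x hx y (.inr hy)
  obtain ⟨T', hT', hsh⟩ := T.exists_replace hR hT1
    (fun r hr => (hp.2.2 r hr _ (.inl rfl)).lower_right hab.le)
    (fun r hr => (hp.2.1.1 r hr).replace_left (hc₂ r hr))
  exact ⟨T', hsh, colReading_replace hR hT' hsh hJ⟩

end YoungTableau

/-! ### Schensted insertion and Knuth equivalence -/

section RowInsertion

variable {A : Type*} [LinearOrder A]

/-- Insertion of the letters of a word in a row; the second component is the word formed by the
letters that are chased away. -/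
def rowInsertWord : List A → List A → List A × List A
  | [], r => (r, [])
  | x :: w, r => ((rowInsertWord w (rowInsert x r).1).1,
      (rowInsert x r).2.toList ++ (rowInsertWord w (rowInsert x r).1).2)

/-- Right Schensted insertion of the letters of a word, on rows listed from bottom to top. -/
def insertUpWord (w : List A) (rs : List (List A)) : List (List A) :=
  w.foldl (fun rs x => insertUp x rs) rs

/-- Upper rows never influence lower ones, so the bottom row can process the whole word before its
bumped letters are passed upwards. This permits induction on the rows. -/
theorem insertUpWord_cons (w : List A) (r : List A) (rs : List (List A)) :
    insertUpWord w (r :: rs) = (rowInsertWord w r).1 :: insertUpWord (rowInsertWord w r).2 rs := by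
  induction w generalizing r rs with
  | nil => rfl
  | cons x w ih =>
    have h : insertUpWord (x :: w) (r :: rs) = insertUpWord w (insertUp x (r :: rs)) := rfl
    rw [h, insertUp, rowInsertWord]
    cases (rowInsert x r).2 with
    | none => exact ih _ _
    | some y => exact ih _ _

theorem insertUpWord_nil {w : List A} (hw : w ≠ []) :
    insertUpWord w [] = insertUpWord w [[]] := by
  cases w with
  | nil => exact absurd rfl hw
  | cons x w => rfl

theorem rowInsertWord_cons {y : A} {w : List A} (hw : ∀ x ∈ w, y ≤ x) (r : List A) :
    rowInsertWord w (y :: r) = (y :: (rowInsertWord w r).1, (rowInsertWord w r).2) := by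
  induction w generalizing r with
  | nil => rfl
  | cons x w ih =>
    simp only [List.mem_cons, forall_eq_or_imp] at hw
    simp only [rowInsertWord, rowInsert, if_neg hw.1.not_gt, ih hw.2]

theorem rowInsert_of_lt_mem {y z : A} {r : List A} (hr : r.Pairwise (· ≤ ·)) (hz : z ∈ r)
    (hyz : y < z) : ∃ y' ∈ r, (rowInsert y r).2 = some y' ∧ y' ≤ z := by
  induction r with
  | nil => simp at hz
  | cons x r ih =>
    rw [List.pairwise_cons] at hr
    by_cases hx : y < x
    · refine ⟨x, by simp, by simp [rowInsert, hx], ?_⟩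
      rcases List.mem_cons.1 hz with rfl | hz
      · exact le_rfl
      · exact hr.1 z hz
    · have hz' : z ∈ r := by
        rcases List.mem_cons.1 hz with rfl | hz
        · exact absurd hyz hx
        · exact hz
      obtain ⟨y', hy', h, h'⟩ := ih hr.2 hz'
      exact ⟨y', by simp [hy'], by simp [rowInsert, hx, h], h'⟩

theorem mem_rowInsert_self (x : A) (r : List A) : x ∈ (rowInsert x r).1 := by
  induction r with
  | nil => simp [rowInsert]
  | cons y r ih => by_cases h : x < y <;> simp [rowInsert, h, ih]

theorem rowInsert_bump_mem {x y : A} {r : List A} (h : (rowInsert x r).2 = some y) : y ∈ r := by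
  induction r with
  | nil => simp [rowInsert] at h
  | cons z r ih =>
    by_cases hz : x < z
    · simp [rowInsert, hz] at h
      simp [h]
    · simp only [rowInsert, hz, if_false] at h
      simp [ih h]

/-- Two letters inserted in non-decreasing order chase away letters in non-decreasing order. -/
theorem rowInsert_rowInsert {y z z' : A} {r : List A} (hr : r.Pairwise (· ≤ ·)) (hyz : y ≤ z)
    (h : (rowInsert z (rowInsert y r).1).2 = some z') :
    ∃ y', (rowInsert y r).2 = some y' ∧ y' ≤ z' := by
  induction r with
  | nil => simp [rowInsert, hyz.not_gt] at h
  | cons x r ih =>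
    rw [List.pairwise_cons] at hr
    by_cases hx : y < x
    · simp only [rowInsert, hx, if_true, if_neg hyz.not_gt] at h ⊢
      exact ⟨x, rfl, hr.1 z' (rowInsert_bump_mem h)⟩
    · simp only [rowInsert, hx, if_false, if_neg ((not_lt.1 hx).trans hyz).not_gt] at h ⊢
      exact ih hr.2 h

theorem KnuthRel.rowInsertWord_nil {s t : List A} (h : KnuthRel s t) :
    rowInsertWord s [] = rowInsertWord t [] := by
  obtain ⟨x, y, z, ⟨h, h', ⟨rfl, rfl⟩ | ⟨rfl, rfl⟩⟩ | ⟨h, h', ⟨rfl, rfl⟩ | ⟨rfl, rfl⟩⟩⟩ := h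
  · simp [rowInsertWord, rowInsert, h.not_gt, h', (h.trans_lt h').not_gt, h.trans_lt h']
  · simp [rowInsertWord, rowInsert, h.not_gt, h', (h.trans_lt h').not_gt, h.trans_lt h']
  · simp [rowInsertWord, rowInsert, h, h'.not_gt, (h.trans_le h').not_gt]
  · simp [rowInsertWord, rowInsert, h, h'.not_gt, (h.trans_le h').not_gt]

/-- Leading letters `w ≤ x` are inert. If `x < w ≤ z`, then `x` bumps `w` in both orders, and the
words bumped differ by a relation of the same kind, provided `z` bumps something. If `z < w` and a
letter `v` follows `w`, they are `w v z` and `w z v`, related by the other kind. -/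
theorem rowInsertWord_xzy {x y z : A} (hxy : x ≤ y) (hyz : y < z) {r : List A}
    (hr : r.Pairwise (· ≤ ·)) :
    (rowInsertWord [x, z, y] r).1 = (rowInsertWord [z, x, y] r).1 ∧
      ((rowInsertWord [x, z, y] r).2 = (rowInsertWord [z, x, y] r).2 ∨
        KnuthRel (rowInsertWord [x, z, y] r).2 (rowInsertWord [z, x, y] r).2) := by
  have hxz := hxy.trans_lt hyz
  induction r with
  | nil =>
    have := (KnuthRel.xzy hxy hyz).rowInsertWord_nil
    exact ⟨by rw [this], .inl (by rw [this])⟩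
  | cons w r ih =>
    rw [List.pairwise_cons] at hr
    rcases le_or_gt w x with hw | hw
    · have h1 := hw.trans hxy
      have h2 := h1.trans hyz.le
      rw [rowInsertWord_cons (by simp [hw, h1, h2]), rowInsertWord_cons (by simp [hw, h1, h2])]
      obtain ⟨h3, h4⟩ := ih hr.2
      exact ⟨by rw [h3], h4⟩
    rcases lt_or_ge z w with hzw | hzw
    · cases r with
      | nil =>
        simp [rowInsertWord, rowInsert, hw, hzw, hxy.not_gt, hxz.not_gt, hxz, hyz]
      | cons v r =>
        have hwv := hr.1 v (by simp)
        have hzv := hzw.trans_le hwv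
        simp only [rowInsertWord, rowInsert, hw, hzw, hxy.not_gt, hxz.not_gt, hxz, hyz, hzv,
          hyz.trans hzv, if_true, if_false, Option.toList_some, List.append_nil,
          List.cons_append, List.nil_append, true_and]
        exact .inr (KnuthRel.yxz hzw hwv).symm
    · have hr' := rowInsert_sorted (x := z) hr.2
      simp only [rowInsertWord, rowInsert, hw, hzw.not_gt, hxy.not_gt, hxz.not_gt, if_true, if_false,
        List.append_nil, true_and]
      cases hb : (rowInsert z r).2 with
      | none => exact .inl (by simp)
      | some z' =>
        obtain ⟨y', hy', h1, h2⟩ := rowInsert_of_lt_mem hr' (mem_rowInsert_self z r) hyz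
        rw [h1]
        refine .inr (.xzy ?_ (h2.trans_lt (lt_of_rowInsert hb)))
        rcases mem_rowInsert hy' with rfl | h
        · exact hzw
        · exact hr.1 _ h

theorem rowInsertWord_yxz {x y z : A} (hxy : x < y) (hyz : y ≤ z) {r : List A}
    (hr : r.Pairwise (· ≤ ·)) :
    (rowInsertWord [y, x, z] r).1 = (rowInsertWord [y, z, x] r).1 ∧
      ((rowInsertWord [y, x, z] r).2 = (rowInsertWord [y, z, x] r).2 ∨
        KnuthRel (rowInsertWord [y, x, z] r).2 (rowInsertWord [y, z, x] r).2) := by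
  have hxz := hxy.trans_le hyz
  induction r with
  | nil =>
    have := (KnuthRel.yxz hxy hyz).rowInsertWord_nil
    exact ⟨by rw [this], .inl (by rw [this])⟩
  | cons w r ih =>
    rw [List.pairwise_cons] at hr
    rcases le_or_gt w x with hw | hw
    · have h1 := hw.trans hxy.le
      have h2 := h1.trans hyz
      rw [rowInsertWord_cons (by simp [hw, h1, h2]), rowInsertWord_cons (by simp [hw, h1, h2])]
      obtain ⟨h3, h4⟩ := ih hr.2
      exact ⟨by rw [h3], h4⟩
    rcases lt_or_ge y w with hyw | hyw
    · simp only [rowInsertWord, rowInsert, hyw, hxy, hyz.not_gt, hxz.not_gt, if_true, if_false,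
        List.append_nil, true_and]
      cases hb : (rowInsert z r).2 with
      | none => exact .inl (by simp)
      | some z' => exact .inr (.yxz hyw (hr.1 _ (rowInsert_bump_mem hb)))
    · simp only [rowInsertWord, rowInsert, hw, hyw.not_gt, (hyw.trans hyz).not_gt, hxz.not_gt,
        if_true, if_false, List.append_nil, true_and]
      cases hb : (rowInsert z (rowInsert y r).1).2 with
      | none => exact .inl (by simp)
      | some z' =>
        obtain ⟨y', h1, h2⟩ := rowInsert_rowInsert hr.2 hyz hb
        rw [h1]
        exact .inr (.yxz (hyw.trans_lt (lt_of_rowInsert h1)) h2)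

theorem KnuthRel.rowInsertWord {s t : List A} (h : KnuthRel s t) {r : List A}
    (hr : r.Pairwise (· ≤ ·)) : (rowInsertWord s r).1 = (rowInsertWord t r).1 ∧
      ((rowInsertWord s r).2 = (rowInsertWord t r).2 ∨
        KnuthRel (rowInsertWord s r).2 (rowInsertWord t r).2) := by
  obtain ⟨x, y, z, ⟨h, h', ⟨rfl, rfl⟩ | ⟨rfl, rfl⟩⟩ | ⟨h, h', ⟨rfl, rfl⟩ | ⟨rfl, rfl⟩⟩⟩ := h
  · exact rowInsertWord_xzy h h' hr
  · have := rowInsertWord_xzy h h' hr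
    exact ⟨this.1.symm, this.2.imp Eq.symm KnuthRel.symm⟩
  · exact rowInsertWord_yxz h h' hr
  · have := rowInsertWord_yxz h h' hr
    exact ⟨this.1.symm, this.2.imp Eq.symm KnuthRel.symm⟩

theorem KnuthRel.ne_nil {s t : List A} (h : KnuthRel s t) : s ≠ [] := by
  obtain ⟨x, y, z, ⟨-, -, ⟨rfl, -⟩ | ⟨rfl, -⟩⟩ | ⟨-, -, ⟨rfl, -⟩ | ⟨rfl, -⟩⟩⟩ := h <;> simp

/-- Each row ends up the same for both words and passes on bumped words that are equal or again
Knuth related; an empty row bumps identical words. -/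
theorem KnuthRel.insertUpWord {s t : List A} (h : KnuthRel s t) {rs : List (List A)}
    (hrs : ∀ r ∈ rs, r.Pairwise (· ≤ ·)) : insertUpWord s rs = insertUpWord t rs := by
  induction rs generalizing s t with
  | nil =>
    rw [insertUpWord_nil h.ne_nil, insertUpWord_nil h.symm.ne_nil, insertUpWord_cons,
      insertUpWord_cons, h.rowInsertWord_nil]
  | cons r rs ih =>
    simp only [List.mem_cons, forall_eq_or_imp] at hrs
    rw [insertUpWord_cons, insertUpWord_cons]
    obtain ⟨h1, h2 | h2⟩ := h.rowInsertWord hrs.1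
    · rw [h1, h2]
    · rw [h1, ih h2 hrs.2]

/-- Each letter of `r` bumps the letter of `u` in its own column, so `r` takes the place of `u` and
expels it intact. -/
theorem rowInsertWord_of_rowGt {u r : List A} (hr : r.Pairwise (· ≤ ·)) (h : RowGt u r) :
    rowInsertWord r u = (r, u) := by
  induction r generalizing u with
  | nil =>
    cases u with
    | nil => rfl
    | cons => exact absurd h not_rowGt_cons_nil
  | cons x r ih =>
    rw [List.pairwise_cons] at hr
    cases u with
    | nil =>
      simp only [rowInsertWord, rowInsert, Option.toList_none, List.nil_append]
      rw [rowInsertWord_cons hr.1, ih hr.2 (rowGt_nil r)]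
    | cons y u =>
      rw [rowGt_cons] at h
      simp only [rowInsertWord, rowInsert, if_pos h.1, Option.toList_some]
      rw [rowInsertWord_cons hr.1, ih hr.2 h.2]
      rfl

theorem insertUpWord_of_chain {r : List A} {rs : List (List A)} (hr : r ≠ [])
    (hs : ∀ u ∈ r :: rs, u.Pairwise (· ≤ ·)) (hne : ∀ u ∈ rs, u ≠ [])
    (h : (r :: rs).IsChain (fun lo up => RowGt up lo)) : insertUpWord r rs = r :: rs := by
  induction rs generalizing r with
  | nil =>
    rw [insertUpWord_nil hr, insertUpWord_cons,
      rowInsertWord_of_rowGt (hs r (by simp)) (rowGt_nil r)]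
    rfl
  | cons u rs ih =>
    rw [List.isChain_cons_cons] at h
    simp only [List.mem_cons, forall_eq_or_imp] at hs hne
    rw [insertUpWord_cons, rowInsertWord_of_rowGt hs.1 h.1,
      ih hne.1 (by simpa using hs.2) hne.2 h.2]

theorem insertUpWord_flatten {rs : List (List A)} (hne : ∀ u ∈ rs, u ≠ [])
    (hs : ∀ u ∈ rs, u.Pairwise (· ≤ ·)) (h : rs.IsChain (fun lo up => RowGt up lo)) :
    insertUpWord rs.reverse.flatten [] = rs := by
  induction rs with
  | nil => rfl
  | cons r rs ih =>
    have hne' : ∀ u ∈ rs, u ≠ [] := fun u hu => hne u (by simp [hu])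
    have h1 := ih hne' (fun u hu => hs u (by simp [hu])) h.tail
    rw [List.reverse_cons, List.flatten_append, List.flatten_singleton, insertUpWord,
      List.foldl_append]
    have h2 := insertUpWord_of_chain (hne r (by simp)) hs hne' h
    rw [insertUpWord] at h1 h2
    rw [h1, h2]

/-- A letter moves to the left through a non-decreasing word of letters exceeding it. -/
theorem knuthEquiv_cons_append_singleton {x y : A} {r : List A} (h : (y :: r).Pairwise (· ≤ ·))
    (hxy : x < y) : KnuthEquiv (y :: r ++ [x]) (y :: x :: r) := by
  induction r generalizing y with
  | nil => exact .refl _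
  | cons z r ih =>
    have hyz : y ≤ z := (List.pairwise_cons.1 h).1 z (by simp)
    have h1 := ih (List.pairwise_cons.1 h).2 (hxy.trans_le hyz)
    refine (KnuthEquiv.append (.refl [y]) h1).trans ?_
    exact .symm (.of_knuthRel (.yxz hxy hyz) [] r)

/-- The inserted letter moves left to its place, after which the bumped letter moves left to the
front of the row. -/
theorem knuthEquiv_rowInsert (x : A) {r : List A} (hr : r.Pairwise (· ≤ ·)) :
    KnuthEquiv ((rowInsert x r).2.toList ++ (rowInsert x r).1) (r ++ [x]) := by
  induction r with
  | nil => exact .refl _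
  | cons y r ih =>
    by_cases hy : x < y
    · simp only [rowInsert, if_pos hy]
      exact .symm (knuthEquiv_cons_append_singleton hr hy)
    · have ih := ih (List.pairwise_cons.1 hr).2
      have hyr := (List.pairwise_cons.1 hr).1
      simp only [rowInsert, if_neg hy]
      have h := KnuthEquiv.append (.refl [y]) ih
      refine KnuthEquiv.trans ?_ h
      cases hb : (rowInsert x r).2 with
      | none => exact .refl _
      | some z =>
        cases r with
        | nil => simp [rowInsert] at hb
        | cons w r =>
          -- The first letter `v` of the new tail witnesses the relation `y z v ∼ z y v`, which
          -- carries the bumped `z` past `y`.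
          obtain ⟨v, r', hv, hyv, hvz⟩ : ∃ v r', (rowInsert x (w :: r)).1 = v :: r' ∧ y ≤ v ∧
              v < z := by
            by_cases hw : x < w
            · simp only [rowInsert, if_pos hw, Option.some.injEq] at hb ⊢
              exact ⟨x, r, rfl, not_lt.1 hy, hb ▸ hw⟩
            · have := lt_of_rowInsert hb
              simp only [rowInsert, if_neg hw]
              exact ⟨w, _, rfl, hyr w (by simp), (not_lt.1 hw).trans_lt this⟩
          rw [hv]
          exact .symm (.of_knuthRel (.xzy hyv hvz) [] r')

theorem knuthEquiv_insertUp (x : A) {rs : List (List A)} (hrs : ∀ r ∈ rs, r.Pairwise (· ≤ ·)) :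
    KnuthEquiv (insertUp x rs).reverse.flatten (rs.reverse.flatten ++ [x]) := by
  induction rs generalizing x with
  | nil => exact .refl _
  | cons r rs ih =>
    simp only [List.mem_cons, forall_eq_or_imp] at hrs
    have h := knuthEquiv_rowInsert x hrs.1
    rw [insertUp]
    cases hb : (rowInsert x r).2 with
    | none =>
      rw [hb] at h
      simpa using KnuthEquiv.append (.refl rs.reverse.flatten) h
    | some y =>
      rw [hb] at h
      have h1 := KnuthEquiv.append (ih y hrs.2) (.refl (rowInsert x r).1)
      have h2 := KnuthEquiv.append (.refl rs.reverse.flatten) h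
      simpa using h1.trans (by simpa using h2)

end RowInsertion

namespace YoungTableau

variable {A : Type*} [LinearOrder A]

theorem rows_foldl_insert (T : YoungTableau A) (w : List A) :
    (w.foldl insert T).rows = (insertUpWord w T.rows.reverse).reverse := by
  induction w generalizing T with
  | nil => simp [insertUpWord]
  | cons x w ih => simp [ih, insert, insertUpWord]

theorem ofWord_append (u v : List A) : ofWord (u ++ v) = v.foldl insert (ofWord u) :=
  List.foldl_append

theorem ofWord_eq_of_knuthEquiv {w w' : List A} (h : KnuthEquiv w w') : ofWord w = ofWord w' := by
  refine KnuthEquiv.induction (P := fun w w' => ofWord w = ofWord w') (fun _ => rfl)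
    (fun s t u v hst => ?_) (fun _ _ _ => Eq.trans) h
  rw [ofWord_append, ofWord_append, ofWord_append, ofWord_append]
  congr 1
  ext1
  rw [rows_foldl_insert, rows_foldl_insert,
    hst.insertUpWord (by simpa using (ofWord u).rows_sorted)]

theorem ofWord_rowReading (T : YoungTableau A) : ofWord T.rowReading = T := by
  ext1
  have h := insertUpWord_flatten (rs := T.rows.reverse) (by simpa using T.rows_ne_nil)
    (by simpa using T.rows_sorted) (List.isChain_reverse.2 T.rows_decreasing)
  rw [List.reverse_reverse] at h
  rw [ofWord, rows_foldl_insert, rowReading]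
  change (insertUpWord T.rows.flatten []).reverse = T.rows
  rw [h, List.reverse_reverse]

theorem knuthEquiv_rowReading_ofWord (w : List A) : KnuthEquiv (ofWord w).rowReading w := by
  induction w using List.reverseRecOn with
  | nil => exact .refl _
  | append_singleton w x ih =>
    have h := knuthEquiv_insertUp x (rs := (ofWord w).rows.reverse)
      (by simpa using (ofWord w).rows_sorted)
    rw [List.reverse_reverse] at h
    rw [ofWord_append]
    exact KnuthEquiv.trans h (ih.append (.refl [x]))

end YoungTableau

/-! ### Knuth equivalence of the row and column readings -/

section ColumnReading

variable {A : Type*} [LinearOrder A]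

/-- The letters of `c` pass to the left of `t` one at a time. Each is smaller than its predecessor,
which then serves as the leading letter for the next move. -/
theorem knuthEquiv_cons_append {x : A} {t c : List A} (ht : (x :: t).Pairwise (· ≤ ·))
    (hc : (x :: c).Pairwise (· > ·)) : KnuthEquiv (x :: t ++ c) (x :: c ++ t) := by
  induction c generalizing x with
  | nil => simpa using KnuthEquiv.refl _
  | cons y c ih =>
    rw [List.pairwise_cons] at hc ht
    have hyx : y < x := hc.1 y (by simp)
    have h1 := (knuthEquiv_cons_append_singleton (List.pairwise_cons.2 ht) hyx).append (.refl c)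
    have h2 := ih (List.pairwise_cons.2 ⟨fun z hz => hyx.le.trans (ht.1 z hz), ht.2⟩) hc.2
    have h3 := KnuthEquiv.append (.refl [x]) h2
    simpa using KnuthEquiv.trans (by simpa using h1) h3

theorem pairwise_firstColumn {R : List (List A)} (hR : R.Pairwise RowGt) :
    (R.filterMap (fun r => r[0]?)).Pairwise (· > ·) := by
  refine List.Pairwise.filterMap _ (fun r s h x hx y hy => ?_) hR
  obtain ⟨z, hz, hzx⟩ := h.getElem? hx
  rw [hy, Option.some.injEq] at hz
  exact hz ▸ hzx

theorem knuthEquiv_firstColumn {R : List (List A)} (hR : R.Pairwise RowGt)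
    (hs : ∀ r ∈ R, r.Pairwise (· ≤ ·)) :
    KnuthEquiv R.flatten (R.filterMap (fun r => r[0]?) ++ (R.map List.tail).flatten) := by
  induction R with
  | nil => exact .refl _
  | cons r R ih =>
    simp only [List.mem_cons, forall_eq_or_imp] at hs
    have h1 := ih (List.pairwise_cons.1 hR).2 hs.2
    cases r with
    | nil => simpa using h1
    | cons x t =>
      have hc := pairwise_firstColumn hR
      simp only [List.filterMap_cons, List.getElem?_cons_zero] at hc
      have h2 := (knuthEquiv_cons_append hs.1 hc).append (.refl (R.map List.tail).flatten)
      have h3 := KnuthEquiv.append (.refl (x :: t)) h1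
      simpa using KnuthEquiv.trans h3 (by simpa using h2)

theorem RowGt.tail {s t : List A} (h : RowGt s t) : RowGt s.tail t.tail := by
  cases s with
  | nil => exact rowGt_nil _
  | cons x s =>
    cases t with
    | nil => exact absurd h not_rowGt_cons_nil
    | cons y t => exact (rowGt_cons.1 h).2

/-- Peel off the first column and continue with the tails of the rows. Empty rows are allowed, since
tails may become empty. -/
theorem knuthEquiv_columns {R : List (List A)} (hR : R.Pairwise RowGt)
    (hs : ∀ r ∈ R, r.Pairwise (· ≤ ·)) {n : ℕ} (hn : ∀ r ∈ R, r.length ≤ n) :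
    KnuthEquiv R.flatten ((List.range n).flatMap fun j => R.filterMap fun r => r[j]?) := by
  induction n generalizing R with
  | zero =>
    have : R.flatten = [] := by simpa using hn
    rw [this]
    exact .refl _
  | succ n ih =>
    have h1 := ih (R := R.map List.tail) (List.pairwise_map.2 (hR.imp RowGt.tail))
      (by
        intro r hr
        obtain ⟨q, hq, rfl⟩ := List.mem_map.1 hr
        exact (hs q hq).sublist (List.tail_sublist q))
      (by
        intro r hr
        obtain ⟨q, hq, rfl⟩ := List.mem_map.1 hr
        have := hn q hq
        simp only [List.length_tail]
        omega)
    refine (knuthEquiv_firstColumn hR hs).trans ?_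
    rw [List.range_succ_eq_map, List.flatMap_cons]
    refine KnuthEquiv.append (.refl _) ?_
    simpa [List.flatMap_map, List.filterMap_map, Function.comp_def] using h1

end ColumnReading

theorem YoungTableau.knuthEquiv_rowReading_colReading {A : Type*} [LinearOrder A]
    (T : YoungTableau A) : KnuthEquiv T.rowReading T.colReading :=
  knuthEquiv_columns T.pairwise_rows T.rows_sorted fun _ => T.length_le_numCols

theorem YoungTableau.ofWord_colReading {A : Type*} [LinearOrder A] (T : YoungTableau A) :
    ofWord T.colReading = T := by
  rw [← ofWord_eq_of_knuthEquiv T.knuthEquiv_rowReading_colReading, ofWord_rowReading]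

/-! ### From single moves to strings -/

section Strings

variable {A : Type*} [LinearOrder A] {a b : A}

theorem KnuthEquiv.length_eq {w w' : List A} (h : KnuthEquiv w w') : w.length = w'.length := by
  refine KnuthEquiv.induction (P := fun w w' => w.length = w'.length) (fun _ => rfl)
    (fun s t u v hst => ?_) (fun _ _ _ => Eq.trans) h
  obtain ⟨x, y, z, ⟨-, -, ⟨rfl, rfl⟩ | ⟨rfl, rfl⟩⟩ | ⟨-, -, ⟨rfl, rfl⟩ | ⟨rfl, rfl⟩⟩⟩ := hst <;>
    simp

theorem KnuthEquiv.exists_sameString (hab : a ⋖ b) {w v x : List A} (h : KnuthEquiv w v)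
    (hx : SameString a b w x) : ∃ y, SameString a b v y ∧ KnuthEquiv x y := by
  refine SameString.induction (P := fun w x => ∀ v, KnuthEquiv w v →
    ∃ y, SameString a b v y ∧ KnuthEquiv x y) (fun w v h => ⟨v, .refl v, h⟩)
    (fun w x hx v h => ?_) (fun w x hx v h => ?_) (fun u v w h1 h2 x hx => ?_) hx v h
  · obtain ⟨y, hy, hxy⟩ := h.exists_raise hab hx
    exact ⟨y, .rel _ _ hy, hxy⟩
  · obtain ⟨y, hy, hxy⟩ := h.exists_raise_to hab hx
    exact ⟨y, SameString.symm (.rel _ _ hy), hxy⟩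
  · obtain ⟨y, hy, hvy⟩ := h1 x hx
    obtain ⟨z, hz, hwz⟩ := h2 y hvy
    exact ⟨z, hy.trans hz, hwz⟩

/-- Follow `w'` along its string in parallel with `w`. The word reached has the right number of free
`a`s, hence is the reflection of `w'`. -/
theorem KnuthEquiv.letterPerm (hab : a ⋖ b) {w w' : List A} (h : KnuthEquiv w w') :
    KnuthEquiv (letterPerm a b w) (letterPerm a b w') := by
  obtain ⟨y, hy, hxy⟩ := h.exists_sameString hab (sameString_letterPerm hab.ne w)
  rwa [← hy.eq_letterPerm hab.ne]
  rw [← (hxy.free hab).1, freeA_letterPerm hab.ne, (h.free hab).2]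

theorem SameString.exists_rowReading (hab : a ⋖ b) {T : YoungTableau A} {x : List A}
    (hx : SameString a b T.rowReading x) :
    ∃ T' : YoungTableau A, T'.shape = T.shape ∧ T'.rowReading = x := by
  refine SameString.induction (P := fun w x => ∀ T : YoungTableau A, T.rowReading = w →
    ∃ T' : YoungTableau A, T'.shape = T.shape ∧ T'.rowReading = x) (fun w T h => ⟨T, rfl, h⟩)
    ?_ ?_ (fun u v w h1 h2 T hT => ?_) hx T rfl
  · rintro _ x hx T rfl
    exact T.exists_raise_rowReading hab hx
  · rintro _ x hx T rfl
    exact T.exists_lower_rowReading hab hx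
  · obtain ⟨T₁, hs, hT₁⟩ := h1 T hT
    obtain ⟨T₂, hs', hT₂⟩ := h2 T₁ hT₁
    exact ⟨T₂, hs'.trans hs, hT₂⟩

theorem SameString.exists_colReading (hab : a ⋖ b) {T : YoungTableau A} {x : List A}
    (hx : SameString a b T.colReading x) :
    ∃ T' : YoungTableau A, T'.shape = T.shape ∧ T'.colReading = x := by
  refine SameString.induction (P := fun w x => ∀ T : YoungTableau A, T.colReading = w →
    ∃ T' : YoungTableau A, T'.shape = T.shape ∧ T'.colReading = x) (fun w T h => ⟨T, rfl, h⟩)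
    ?_ ?_ (fun u v w h1 h2 T hT => ?_) hx T rfl
  · rintro _ x hx T rfl
    exact T.exists_raise_colReading hab hx
  · rintro _ x hx T rfl
    exact T.exists_lower_colReading hab hx
  · obtain ⟨T₁, hs, hT₁⟩ := h1 T hT
    obtain ⟨T₂, hs', hT₂⟩ := h2 T₁ hT₁
    exact ⟨T₂, hs'.trans hs, hT₂⟩

theorem SameString.mem_rowReadings (hab : a ⋖ b) {lam : List ℕ} {w x : List A}
    (hx : SameString a b w x) (hw : w ∈ rowReadings A lam) : x ∈ rowReadings A lam := by
  obtain ⟨T, rfl, rfl⟩ := hw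
  exact hx.exists_rowReading hab

theorem SameString.mem_colReadings (hab : a ⋖ b) {lam : List ℕ} {w x : List A}
    (hx : SameString a b w x) (hw : w ∈ colReadings A lam) : x ∈ colReadings A lam := by
  obtain ⟨T, rfl, rfl⟩ := hw
  exact hx.exists_colReading hab

theorem length_of_mem_rowReadings {lam : List ℕ} {w : List A} (h : w ∈ rowReadings A lam) :
    w.length = lam.sum := by
  obtain ⟨T, rfl, rfl⟩ := h
  rw [YoungTableau.rowReading, List.length_flatten, YoungTableau.shape]

theorem length_of_mem_colReadings {lam : List ℕ} {w : List A} (h : w ∈ colReadings A lam) :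
    w.length = lam.sum := by
  obtain ⟨T, hT, rfl⟩ := h
  rw [← T.knuthEquiv_rowReading_colReading.length_eq]
  exact length_of_mem_rowReadings ⟨T, hT, rfl⟩

/-- The reflected word is already a row reading, and the tableau map inverts row reading. -/
theorem YoungTableau.rowReading_ofWord_letterPerm (hab : a ⋖ b) (T : YoungTableau A) :
    (ofWord (letterPerm a b T.rowReading)).rowReading = letterPerm a b T.rowReading := by
  obtain ⟨T', -, hT'⟩ := (sameString_letterPerm hab.ne T.rowReading).exists_rowReading hab
  rw [← hT', ofWord_rowReading]

theorem YoungTableau.colReading_ofWord_letterPerm (hab : a ⋖ b) (T : YoungTableau A) :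
    (ofWord (letterPerm a b T.rowReading)).colReading = letterPerm a b T.colReading := by
  obtain ⟨T', -, hT'⟩ := (sameString_letterPerm hab.ne T.colReading).exists_colReading hab
  rw [ofWord_eq_of_knuthEquiv (T.knuthEquiv_rowReading_colReading.letterPerm hab), ← hT',
    ofWord_colReading]

theorem YoungTableau.ofWord_letterPerm (hab : a ⋖ b) (w : List A) :
    ofWord (letterPerm a b w) = ofWord (letterPerm a b (ofWord w).rowReading) :=
  (ofWord_eq_of_knuthEquiv ((knuthEquiv_rowReading_ofWord w).letterPerm hab)).symm

end Strings

/-! ### Products of words and parallel moves of Knuth equivalent factors -/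

section Products

variable {A : Type*} [LinearOrder A] {a b : A}

theorem KnuthEquiv.flatten {ws vs : List (List A)} (h : List.Forall₂ KnuthEquiv ws vs) :
    KnuthEquiv ws.flatten vs.flatten := by
  induction h with
  | nil => exact .refl _
  | cons h _ ih => exact h.append ih

theorem SameString.forall₂_refl (ws : List (List A)) : List.Forall₂ (SameString a b) ws ws :=
  List.forall₂_same.2 fun w _ => .refl w

theorem exists_raise_flatten (hab : a ⋖ b) {ws vs : List (List A)}
    (h : List.Forall₂ KnuthEquiv ws vs) {x : List A} (hx : Raise a b ws.flatten x) :
    ∃ ws' vs' : List (List A), x = ws'.flatten ∧ SameString a b vs.flatten vs'.flatten ∧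
      List.Forall₂ KnuthEquiv ws' vs' ∧ List.Forall₂ (SameString a b) ws ws' ∧
      List.Forall₂ (SameString a b) vs vs' := by
  -- The induction needs a single raise of the second product, since only a single raise extends to
  -- a longer product by the signature rule.
  suffices ∃ ws' vs' : List (List A), x = ws'.flatten ∧ Raise a b vs.flatten vs'.flatten ∧
      List.Forall₂ KnuthEquiv ws' vs' ∧ List.Forall₂ (SameString a b) ws ws' ∧
      List.Forall₂ (SameString a b) vs vs' by
    obtain ⟨ws', vs', h1, h2, h3⟩ := this
    exact ⟨ws', vs', h1, .rel _ _ h2, h3⟩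
  induction h generalizing x with
  | nil => obtain ⟨u, v, h, -⟩ := hx; simp at h
  | @cons w v ws vs hwv hs ih =>
    have hf := hwv.free hab
    have hF := (KnuthEquiv.flatten hs).free hab
    rw [List.flatten_cons] at hx
    rcases hx.of_append_left with ⟨w', rfl, hw', hc⟩ | ⟨F, rfl, hF', hc⟩
    · obtain ⟨v', hv', hwv'⟩ := hwv.exists_raise hab hw'
      refine ⟨w' :: ws, v' :: vs, rfl, hv'.append_right ?_, .cons hwv' hs,
        .cons (.rel _ _ hw') (SameString.forall₂_refl _),
        .cons (.rel _ _ hv') (SameString.forall₂_refl _)⟩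
      rwa [← hF.1, ← hf.2]
    · obtain ⟨ws', vs', rfl, h1, h2, h3, h4⟩ := ih hF'
      refine ⟨w :: ws', v :: vs', rfl, h1.append_left' hab.ne ?_, .cons hwv h2,
        .cons (.refl _) h3, .cons (.refl _) h4⟩
      rwa [← hF.1, ← hf.2]

theorem exists_lower_flatten (hab : a ⋖ b) {ws vs : List (List A)}
    (h : List.Forall₂ KnuthEquiv ws vs) {x : List A} (hx : Raise a b x ws.flatten) :
    ∃ ws' vs' : List (List A), x = ws'.flatten ∧ SameString a b vs.flatten vs'.flatten ∧
      List.Forall₂ KnuthEquiv ws' vs' ∧ List.Forall₂ (SameString a b) ws ws' ∧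
      List.Forall₂ (SameString a b) vs vs' := by
  suffices ∃ ws' vs' : List (List A), x = ws'.flatten ∧ Raise a b vs'.flatten vs.flatten ∧
      List.Forall₂ KnuthEquiv ws' vs' ∧ List.Forall₂ (SameString a b) ws ws' ∧
      List.Forall₂ (SameString a b) vs vs' by
    obtain ⟨ws', vs', h1, h2, h3⟩ := this
    exact ⟨ws', vs', h1, SameString.symm (.rel _ _ h2), h3⟩
  induction h generalizing x with
  | nil => obtain ⟨u, v, -, h, -⟩ := hx; simp at h
  | @cons w v ws vs hwv hs ih =>
    have hf := hwv.free hab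
    have hF := (KnuthEquiv.flatten hs).free hab
    rw [List.flatten_cons] at hx
    rcases hx.of_append_right hab.ne with ⟨w', rfl, hw', hc⟩ | ⟨F, rfl, hF', hc⟩
    · obtain ⟨v', hv', hwv'⟩ := hwv.exists_raise_to hab hw'
      refine ⟨w' :: ws, v' :: vs, rfl, hv'.append_right' hab.ne ?_, .cons hwv' hs,
        .cons (SameString.symm (.rel _ _ hw')) (SameString.forall₂_refl _),
        .cons (SameString.symm (.rel _ _ hv')) (SameString.forall₂_refl _)⟩
      rwa [← hF.1, ← hf.2]
    · obtain ⟨ws', vs', rfl, h1, h2, h3, h4⟩ := ih hF'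
      refine ⟨w :: ws', v :: vs', rfl, h1.append_left hab.ne ?_, .cons hwv h2,
        .cons (.refl _) h3, .cons (.refl _) h4⟩
      rwa [← hF.1, ← hf.2]

theorem forall₂_trans {α : Type*} {R : α → α → Prop} (hR : ∀ x y z, R x y → R y z → R x z)
    {l₁ l₂ l₃ : List α} (h : List.Forall₂ R l₁ l₂) (h' : List.Forall₂ R l₂ l₃) :
    List.Forall₂ R l₁ l₃ := by
  induction h generalizing l₃ with
  | nil => exact h'
  | cons h _ ih =>
    cases h' with
    | cons h1 h2 => exact .cons (hR _ _ _ h h1) (ih h2)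

theorem exists_sameString_flatten (hab : a ⋖ b) {ws vs : List (List A)}
    (h : List.Forall₂ KnuthEquiv ws vs) {x : List A} (hx : SameString a b ws.flatten x) :
    ∃ ws' vs' : List (List A), x = ws'.flatten ∧ SameString a b vs.flatten vs'.flatten ∧
      List.Forall₂ KnuthEquiv ws' vs' ∧ List.Forall₂ (SameString a b) ws ws' ∧
      List.Forall₂ (SameString a b) vs vs' := by
  refine SameString.induction (P := fun w x => ∀ ws vs : List (List A), ws.flatten = w →
    List.Forall₂ KnuthEquiv ws vs →
    ∃ ws' vs' : List (List A), x = ws'.flatten ∧ SameString a b vs.flatten vs'.flatten ∧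
      List.Forall₂ KnuthEquiv ws' vs' ∧ List.Forall₂ (SameString a b) ws ws' ∧
      List.Forall₂ (SameString a b) vs vs') ?_ ?_ ?_ ?_ hx ws vs rfl h
  · rintro _ ws vs rfl h
    exact ⟨ws, vs, rfl, .refl _, h, SameString.forall₂_refl _, SameString.forall₂_refl _⟩
  · rintro _ x hx ws vs rfl h
    exact exists_raise_flatten hab h hx
  · rintro _ x hx ws vs rfl h
    exact exists_lower_flatten hab h hx
  · intro u v w h1 h2 ws vs hw h
    obtain ⟨ws₁, vs₁, e₁, hv₁, hk₁, hws₁, hvs₁⟩ := h1 ws vs hw h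
    obtain ⟨ws₂, vs₂, e₂, hv₂, hk₂, hws₂, hvs₂⟩ := h2 ws₁ vs₁ e₁.symm hk₁
    exact ⟨ws₂, vs₂, e₂, hv₁.trans hv₂, hk₂,
      forall₂_trans (fun _ _ _ => SameString.trans) hws₁ hws₂,
      forall₂_trans (fun _ _ _ => SameString.trans) hvs₁ hvs₂⟩

theorem forall₂_ofFn {α : Type*} {R : α → α → Prop} {k : ℕ} {f g : Fin k → α} :
    List.Forall₂ R (List.ofFn f) (List.ofFn g) ↔ ∀ j, R (f j) (g j) := by
  induction k with
  | zero => simp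
  | succ k ih => simp [List.ofFn_succ, ih, Fin.forall_fin_succ]

theorem exists_ofFn_of_forall₂ {α : Type*} {R : α → α → Prop} {k : ℕ} {f : Fin k → α}
    {l : List α} (h : List.Forall₂ R (List.ofFn f) l) :
    ∃ g : Fin k → α, l = List.ofFn g ∧ ∀ j, R (f j) (g j) := by
  obtain rfl : l.length = k := by simpa using h.length_eq.symm
  refine ⟨l.get, (List.ofFn_get l).symm, ?_⟩
  refine forall₂_ofFn.1 ?_
  rwa [List.ofFn_get]

theorem concat_injective {α : Type*} {k : ℕ} {f g : Fin k → List α}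
    (hl : ∀ j, (f j).length = (g j).length) (h : concat f = concat g) : f = g := by
  induction k with
  | zero => exact Subsingleton.elim f g
  | succ k ih =>
    simp only [concat, List.ofFn_succ, List.flatten_cons] at h
    obtain ⟨h0, h1⟩ := List.append_inj h (hl 0)
    have h2 := ih (fun j => hl j.succ) h1
    funext j
    refine Fin.cases h0 (fun j => ?_) j
    exact congrFun h2 j

/-- The letter permuting operators act on a product of words by moving each factor along its
string, in the same way for Knuth equivalent factors. -/
theorem exists_letterPerm_concat (hab : a ⋖ b) {k : ℕ} {w v : Fin k → List A}
    (h : ∀ j, KnuthEquiv (w j) (v j)) :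
    ∃ w' v' : Fin k → List A, letterPerm a b (concat w) = concat w' ∧
      letterPerm a b (concat v) = concat v' ∧ (∀ j, KnuthEquiv (w' j) (v' j)) ∧
      (∀ j, SameString a b (w j) (w' j)) ∧ ∀ j, SameString a b (v j) (v' j) := by
  have h0 := forall₂_ofFn.2 h
  obtain ⟨ws, vs, e, hv, hk, h1, h2⟩ := exists_sameString_flatten hab h0
    (sameString_letterPerm hab.ne (concat w))
  have hk' := KnuthEquiv.flatten hk
  obtain ⟨w', rfl, hw'⟩ := exists_ofFn_of_forall₂ h1
  obtain ⟨v', rfl, hv'⟩ := exists_ofFn_of_forall₂ h2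
  -- The second product was only moved along its string; Knuth invariance of the counts shows that
  -- it stopped at its own reflection.
  refine ⟨w', v', e, (hv.eq_letterPerm hab.ne ?_).symm, forall₂_ofFn.1 hk, hw', hv'⟩
  rw [← (hk'.free hab).1, ← e, freeA_letterPerm hab.ne]
  exact ((KnuthEquiv.flatten h0).free hab).2

end Products

/-! ### Specialization to the alphabet and the main theorem -/

theorem alphabet_covBy {n : ℕ∞} {i : ℕ} (hi : 1 ≤ i ∧ (i : ℕ∞) ≤ n)
    (hi' : 1 ≤ i + 1 ∧ ((i + 1 : ℕ) : ℕ∞) ≤ n) :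
    (⟨i, hi⟩ : Alphabet n) ⋖ ⟨i + 1, hi'⟩ := by
  refine ⟨Subtype.mk_lt_mk.2 (Nat.lt_succ_self i), fun c h1 h2 => ?_⟩
  have h1 : i < c.1 := h1
  have h2 : c.1 < i + 1 := h2
  omega

theorem exists_sWord_eq_letterPerm (n : ℕ∞) (i : ℕ) (hi : 1 ≤ i) (hn : (i : ℕ∞) < n) :
    ∃ a b : Alphabet n, a ⋖ b ∧ sWord i hi hn = letterPerm a b := by
  refine ⟨⟨i, hi, hn.le⟩, ⟨i + 1, Nat.le_add_left 1 i, ?_⟩, alphabet_covBy _ _, ?_⟩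
  · push_cast
    exact Order.add_one_le_of_lt hn
  · funext w
    unfold sWord
    congr

end Plactic

open Plactic Plactic.YoungTableau

theorem mainTheorem10 (n : ℕ∞) (i : ℕ) (hi : 1 ≤ i) (hn : (i : ℕ∞) < n) :
    -- the operators on the plactic monoid and on tableaux induced by `s_i` are well defined
    ((∀ w w' : List (Plactic.Alphabet n), Plactic.KnuthEquiv w w' →
        Plactic.KnuthEquiv (Plactic.sWord i hi hn w) (Plactic.sWord i hi hn w')) ∧
      (∀ w : List (Plactic.Alphabet n),
        Plactic.YoungTableau.ofWord (Plactic.sWord i hi hn w) =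
          Plactic.sTableau i hi hn (Plactic.YoungTableau.ofWord w))) ∧
    -- 1. the `s_i` restrict to the readings of tableaux of a given shape
    (∀ lam : List ℕ,
      Set.MapsTo (Plactic.sWord i hi hn)
        (Plactic.rowReadings (Plactic.Alphabet n) lam)
        (Plactic.rowReadings (Plactic.Alphabet n) lam) ∧
      Set.MapsTo (Plactic.sWord i hi hn)
        (Plactic.colReadings (Plactic.Alphabet n) lam)
        (Plactic.colReadings (Plactic.Alphabet n) lam)) ∧
    -- 2. the readings are injective and intertwine the induced and the restricted `s_i`
    ((Function.Injective (Plactic.YoungTableau.rowReading (A := Plactic.Alphabet n)) ∧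
        ∀ T : Plactic.YoungTableau (Plactic.Alphabet n),
          (Plactic.sTableau i hi hn T).rowReading = Plactic.sWord i hi hn T.rowReading) ∧
      (Function.Injective (Plactic.YoungTableau.colReading (A := Plactic.Alphabet n)) ∧
        ∀ T : Plactic.YoungTableau (Plactic.Alphabet n),
          (Plactic.sTableau i hi hn T).colReading = Plactic.sWord i hi hn T.colReading)) ∧
    -- 3. the `s_i` commute with `R ∘ T` and `C ∘ T` on words
    (∀ w : List (Plactic.Alphabet n),
      Plactic.sWord i hi hn (Plactic.YoungTableau.ofWord w).rowReading =
          (Plactic.YoungTableau.ofWord (Plactic.sWord i hi hn w)).rowReading ∧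
        Plactic.sWord i hi hn (Plactic.YoungTableau.ofWord w).colReading =
          (Plactic.YoungTableau.ofWord (Plactic.sWord i hi hn w)).colReading) ∧
    -- 4. the image of a product of readings decomposes into readings of the same shapes
    (∀ (k : ℕ) (lam : Fin k → List ℕ) (w : Fin k → List (Plactic.Alphabet n)),
      ((∀ j, w j ∈ Plactic.rowReadings (Plactic.Alphabet n) (lam j)) →
        ∃! w' : Fin k → List (Plactic.Alphabet n),
          Plactic.sWord i hi hn (Plactic.concat w) = Plactic.concat w' ∧
            ∀ j, w' j ∈ Plactic.rowReadings (Plactic.Alphabet n) (lam j)) ∧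
      ((∀ j, w j ∈ Plactic.colReadings (Plactic.Alphabet n) (lam j)) →
        ∃! w' : Fin k → List (Plactic.Alphabet n),
          Plactic.sWord i hi hn (Plactic.concat w) = Plactic.concat w' ∧
            ∀ j, w' j ∈ Plactic.colReadings (Plactic.Alphabet n) (lam j))) ∧
    -- 5. the row and column versions of this decomposition give the same tableaux
    (∀ (k : ℕ) (T : Fin k → Plactic.YoungTableau (Plactic.Alphabet n))
      (w' v' : Fin k → List (Plactic.Alphabet n)),
      (Plactic.sWord i hi hn (Plactic.concat fun j => (T j).rowReading) = Plactic.concat w' ∧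
        ∀ j, w' j ∈ Plactic.rowReadings (Plactic.Alphabet n) (T j).shape) →
      (Plactic.sWord i hi hn (Plactic.concat fun j => (T j).colReading) = Plactic.concat v' ∧
        ∀ j, v' j ∈ Plactic.colReadings (Plactic.Alphabet n) (T j).shape) →
      ∀ j, Plactic.YoungTableau.ofWord (w' j) = Plactic.YoungTableau.ofWord (v' j)) := by
  obtain ⟨a, b, hab, hs⟩ := exists_sWord_eq_letterPerm n i hi hn
  have hT : ∀ T, sTableau i hi hn T = ofWord (letterPerm a b T.rowReading) := fun T => by
    rw [sTableau, hs]
  simp only [hT, hs]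
  have h2 : ∀ w : List (Alphabet n),
      ofWord (letterPerm a b w) = ofWord (letterPerm a b (ofWord w).rowReading) :=
    ofWord_letterPerm hab
  have hR : ∀ (lam : List ℕ) {w x : List (Alphabet n)}, SameString a b w x →
      w ∈ rowReadings (Alphabet n) lam → x ∈ rowReadings (Alphabet n) lam :=
    fun lam w x h => h.mem_rowReadings hab
  have hC : ∀ (lam : List ℕ) {w x : List (Alphabet n)}, SameString a b w x →
      w ∈ colReadings (Alphabet n) lam → x ∈ colReadings (Alphabet n) lam :=
    fun lam w x h => h.mem_colReadings hab
  refine ⟨⟨fun w w' h => h.letterPerm hab, h2⟩,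
    fun lam => ⟨fun w hw => hR lam (sameString_letterPerm hab.ne w) hw,
      fun w hw => hC lam (sameString_letterPerm hab.ne w) hw⟩,
    ⟨⟨Function.LeftInverse.injective ofWord_rowReading, rowReading_ofWord_letterPerm hab⟩,
      ⟨Function.LeftInverse.injective ofWord_colReading, colReading_ofWord_letterPerm hab⟩⟩,
    fun w => ⟨by rw [h2]; exact (rowReading_ofWord_letterPerm hab _).symm,
      by rw [h2]; exact (colReading_ofWord_letterPerm hab _).symm⟩,
    fun k lam w => ⟨fun hw => ?_, fun hw => ?_⟩, fun k T w' v' hw hv => ?_⟩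
  -- For existence the parallel family is the given one itself; uniqueness holds because the shapes
  -- prescribe the lengths of the factors.
  · obtain ⟨w', -, e, -, -, hw', -⟩ :=
      exists_letterPerm_concat hab fun j => KnuthEquiv.refl (w j)
    have hm : ∀ j, w' j ∈ rowReadings (Alphabet n) (lam j) := fun j => hR _ (hw' j) (hw j)
    refine ⟨w', ⟨e, hm⟩, fun x hx => concat_injective (fun j => ?_) (hx.1.symm.trans e)⟩
    rw [length_of_mem_rowReadings (hx.2 j), length_of_mem_rowReadings (hm j)]
  · obtain ⟨w', -, e, -, -, hw', -⟩ :=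
      exists_letterPerm_concat hab fun j => KnuthEquiv.refl (w j)
    have hm : ∀ j, w' j ∈ colReadings (Alphabet n) (lam j) := fun j => hC _ (hw' j) (hw j)
    refine ⟨w', ⟨e, hm⟩, fun x hx => concat_injective (fun j => ?_) (hx.1.symm.trans e)⟩
    rw [length_of_mem_colReadings (hx.2 j), length_of_mem_colReadings (hm j)]
  · obtain ⟨w₁, v₁, ew, ev, hk, hw₁, hv₁⟩ :=
      exists_letterPerm_concat hab fun j => (T j).knuthEquiv_rowReading_colReading
    -- By uniqueness, the given decompositions are those obtained by moving the row and column
    -- readings in parallel, whose factors are Knuth equivalent.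
    have e1 : w' = w₁ := concat_injective (fun j => by
      rw [length_of_mem_rowReadings (hw.2 j),
        length_of_mem_rowReadings (hR _ (hw₁ j) ⟨T j, rfl, rfl⟩)]) (hw.1.symm.trans ew)
    have e2 : v' = v₁ := concat_injective (fun j => by
      rw [length_of_mem_colReadings (hv.2 j),
        length_of_mem_colReadings (hC _ (hv₁ j) ⟨T j, rfl, rfl⟩)]) (hv.1.symm.trans ev)
    intro j
    rw [e1, e2]
    exact ofWord_eq_of_knuthEquiv (hk j)
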